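/- Let $\Omega=\{-1,+1\}^{\mathbb Z^2}$ carry the product topology, let $\beta\in\mathbb R$, and consider the zero-field heat-bath Glauber dynamics on $\Omega$ for the nearest-neighbour Ising model at inverse temperature $\beta$, given by the Harris graphical representation: the sites carry independent Poisson clocks of rate one, whose rings carry independent marks uniform on $[0,1]$; when the clock of $i$ rings with mark $v$, the spin at $i$ becomes $+1$ if $v\le \dfrac{e^{\beta h_i}}{e^{\beta h_i}+e^{-\beta h_i}}$ and $-1$ otherwise, where $h_i=\sum_{j\sim i}\sigma_j$ is the sum of the four neighbouring spins just before the ring; between its rings the spin at $i$ does not change. For $\xi\in\Omega$ let $\mathbb P_\xi$ be the law of the dynamics started from $\xi$ on the path space $D([0,\infty),\Omega)$ of right-continuous paths with left limits, equipped with the $\sigma$-algebra generated by the evaluations (the Borel $\sigma$-algebra of the Skorokhod topology), and let $P_u(\xi,\cdot)=\mathbb P_\xi(\sigma_u\in\cdot)$ be the transition probabilities, $u\ge0$. **Proposition (maximal pathwise confinement sets).** Let $C\subset\Omega$ be Borel, and let $$S_C=\{\xi\in C:\ \mathbb P_\xi(\sigma_t\in C\ \text{for all }t\ge0)=1\}$$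 be the set of initial configurations in $C$ whose trajectories almost surely remain in $C$ at all times. Then $S_C$ is universally measurable, i.e. it belongs to the completion of the Borel $\sigma$-algebra of $\Omega$ with respect to every finite Borel measure, and it is semigroup-absorbing: for every $\xi\in S_C$ and every $u\ge0$, $$P_u(\xi,S_C)=1,$$ where $P_u(\xi,\cdot)$ is extended to universally measurable sets by completion. -/

import Mathlib

open MeasureTheory ProbabilityTheory Filter Topology
open scoped NNReal

noncomputable section

namespace IsingGlauber

/-- Sites of the square lattice. -/
abbrev Site : Type := ℤ × ℤ

/-- The numerical value of a spin: `true` stands for `+1` and `false` for `-1`. -/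
def spinValue (s : Bool) : ℝ := if s then 1 else -1

/-- The configuration space `{-1,+1}^(ℤ²)`, with the product of the discrete topologies. Its product
σ-algebra is its Borel σ-algebra, because the index set is countable. -/
abbrev Config : Type := Site → Bool

/-- The sum of the four nearest-neighbour spins of `i`. -/
def localField (σ : Config) (i : Site) : ℝ :=
  spinValue (σ (i.1 + 1, i.2)) + spinValue (σ (i.1 - 1, i.2)) +
    spinValue (σ (i.1, i.2 + 1)) + spinValue (σ (i.1, i.2 - 1))

/-- Zero-field heat-bath probability: the conditional Ising--Gibbs probability, at inverse
temperature `β`, of a plus spin at `i` given the other spins `σ`. -/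
def plusProb (β : ℝ) (σ : Config) (i : Site) : ℝ :=
  Real.exp (β * localField σ i) /
    (Real.exp (β * localField σ i) + Real.exp (-(β * localField σ i)))

/-- The heat-bath update of site `i` with mark `v`: plus if `v ≤ plusProb β σ i`, minus otherwise. -/
def heatBath (β : ℝ) (v : ℝ) (σ : Config) (i : Site) : Bool :=
  decide (v ≤ plusProb β σ i)

/-! ### The Harris noise -/

/-- A noise realization attaches to the site `i` and the index `k` the waiting time between the
rings `k - 1` and `k` of the clock at `i` (counted from `k = 0`, with the waiting time from time `0`
at `k = 0`), and the mark of ring `k`. -/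
abbrev Noise : Type := Site × ℕ → ℝ × ℝ

/-- The law of one waiting time (exponential of rate one) and one independent mark (uniform on the
unit interval). -/
def ringLaw : Measure (ℝ × ℝ) :=
  (expMeasure 1).prod (volume.restrict (Set.Icc (0 : ℝ) 1))

/-- The law of the noise: all waiting times and all marks are independent. Thus the clocks are
independent Poisson processes of rate one with independent uniform marks. -/
def noiseLaw : Measure Noise := Measure.infinitePi fun _ => ringLaw

instance : IsProbabilityMeasure ringLaw := by
  have : IsProbabilityMeasure (expMeasure 1) := isProbabilityMeasure_expMeasure one_pos
  have : IsProbabilityMeasure (volume.restrict (Set.Icc (0 : ℝ) 1)) := ⟨by simp⟩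
  unfold ringLaw
  infer_instance

instance : IsProbabilityMeasure noiseLaw := by
  unfold noiseLaw
  infer_instance

/-- The time of ring `k` of the clock at `i`. -/
def ringTime (w : Noise) (i : Site) (k : ℕ) : ℝ := ∑ j ∈ Finset.range (k + 1), (w (i, j)).1

/-- The mark of ring `k` of the clock at `i`. -/
def mark (w : Noise) (i : Site) (k : ℕ) : ℝ := (w (i, k)).2

/-- The number of rings at `i` strictly before time `s`. -/
def ringsBefore (w : Noise) (i : Site) (s : ℝ) : ℕ := {k : ℕ | ringTime w i k < s}.ncard

/-- The number of rings at `i` up to and including time `s`. -/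
def ringsUpTo (w : Noise) (i : Site) (s : ℝ) : ℕ := {k : ℕ | ringTime w i k ≤ s}.ncard

/-! ### The graphical construction -/

/-- The spin at `i` after the first `m` rings of its clock, when the history is explored backwards
through at most `n` generations of rings, spins beyond the last generation being replaced by their
initial values. At its ring `m` (the ring number `m + 1` of its clock) the site `i` performs a
heat-bath update using the spins of its neighbours just before the time of that ring. -/
def spinAfter (β : ℝ) (ξ : Config) (w : Noise) : ℕ → Site → ℕ → Bool
  | 0, i, _ => ξ i
  | _ + 1, i, 0 => ξ i
  | n + 1, i, m + 1 =>
      heatBath β (mark w i m)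
        (fun j => spinAfter β ξ w n j (ringsBefore w j (ringTime w i m))) i

open Classical in
/-- The Harris process: the spin at `i` at time `t`, started from `ξ`. Almost surely every backward
exploration is finite, so that `spinAfter β ξ w n` is eventually constant in `n`; the spin is this
eventual value. -/
def harrisState (β : ℝ) (ξ : Config) (w : Noise) (t : ℝ≥0) : Config :=
  fun i => decide (∀ᶠ n in atTop, spinAfter β ξ w n i (ringsUpTo w i t) = true)

/-! ### Path space, path laws and the semigroup -/

/-- Right-continuous paths with left limits. -/
def IsCadlag (ω : ℝ≥0 → Config) : Prop :=
  ∀ t, ContinuousWithinAt ω (Set.Ici t) t ∧ ∃ l, Tendsto ω (𝓝[<] t) (𝓝 l)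

/-- The path space `D([0,∞), Ω)`, with the σ-algebra generated by the evaluations, which is the
Borel σ-algebra of the Skorokhod topology. -/
abbrev PathSpace : Type := {ω : ℝ≥0 → Config // IsCadlag ω}

theorem isCadlag_const (ξ : Config) : IsCadlag fun _ => ξ :=
  fun _ => ⟨continuousWithinAt_const, ξ, tendsto_const_nhds⟩

open Classical in
/-- The trajectory of the Harris process started from `ξ`. It is almost surely càdlàg; on the
remaining null event the constant path is used instead. -/
def harrisPath (β : ℝ) (ξ : Config) (w : Noise) : PathSpace :=
  if h : IsCadlag (harrisState β ξ w) then ⟨harrisState β ξ w, h⟩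
  else ⟨fun _ => ξ, isCadlag_const ξ⟩

/-- The law `ℙ_ξ` on path space of the heat-bath Glauber dynamics started from `ξ`. -/
def pathLaw (β : ℝ) (ξ : Config) : Measure PathSpace := noiseLaw.map (harrisPath β ξ)

/-- The transition probability `P_u(ξ, ·)`: the law of the configuration at time `u` under `ℙ_ξ`. -/
def transition (β : ℝ) (u : ℝ≥0) (ξ : Config) : Measure Config :=
  (pathLaw β ξ).map fun ω => ω.1 u

/-! ### Confinement -/

/-- The event `H_C` that the path is in `C` at all times. -/
def stayEvent (C : Set Config) : Set PathSpace := {ω | ∀ t, ω.1 t ∈ C}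

/-- The maximal pathwise confinement set `S_C`: the `ξ ∈ C` whose trajectory stays in `C` for all
times almost surely. -/
def confinementSet (β : ℝ) (C : Set Config) : Set Config :=
  C ∩ {ξ | ∀ᵐ ω ∂(pathLaw β ξ), ω ∈ stayEvent C}

/-- A set is universally measurable if it belongs to the completion of the σ-algebra with respect to
every finite measure. -/
def IsUniversallyMeasurable {X : Type*} [MeasurableSpace X] (S : Set X) : Prop :=
  ∀ μ : Measure X, IsFiniteMeasure μ → NullMeasurableSet S μ

end IsingGlauber

end

/-!
The confinement set is universally measurable because leaving `C` is an analytic event, and it is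
absorbing because of the Markov property at the fixed time `u`.

**Markov property by splicing.** Instead of conditioning on the past of the noise, two independent
noises `x` and `y` are spliced: `spliceNoise u x y` follows `x` up to time `u` and `y`, with its
clocks started at time `u`, afterwards. Since exponential waiting times are memoryless, the
spliced noise has the law of the noise (`measurePreserving_spliceNoise`). The process driven by it
is, after time `u`, the process driven by `y` started from the state reached under `x` at time `u`
(`harrisState_splice_add`). If the process started from `ξ` stays in `C` almost surely, then by
Fubini's theorem, for almost every `x`, the process started from the state under `x` at time `u`
stays in `C` for almost every `y`; so this state lies in the confinement set
(`ae_harrisState_mem_confinementSet`).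

**The graphical construction.** These identities hold where the backward exploration is finite,
that is, well founded. An infinite exploration has decreasing ring times, so it ends up in one
time window of length `1/8`, where it gives arbitrarily long self-avoiding walks of ringing sites
(`RegularClocks.wellFounded`). By the Markov property a site rings in a given window with
probability at most `1/8`, independently for different sites, and there are at most `4 ^ n` walks
of `n` steps, so this almost surely does not happen (`ae_exists_forall_walks`).

**Measurability.** By right continuity a path is determined by its values on the countable grid of
times `k / (n + 1)`, in a jointly measurable way (`fromGrid`). So the paths that leave `C` are
those whose grid samples lie in the projection `exitSamples C` of a Borel set, which is analytic
and hence measurable for the completion of every finite measure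
(`nullMeasurableSet_of_analyticSet`). Applied to the law of the samples under a random initial
configuration, this yields a Borel set that agrees with the confinement set almost everywhere.
-/

namespace IsingGlauber

open scoped ENNReal

/-! ### Analytic sets are universally measurable -/

/-- The sequences whose first `n` terms are bounded by those of `k`. -/
def boundedPrefix (k : ℕ → ℕ) (n : ℕ) : Set (ℕ → ℕ) := {x | ∀ i < n, x i ≤ k i}

theorem boundedPrefix_congr {k l : ℕ → ℕ} {n : ℕ} (h : ∀ i < n, k i = l i) :
    boundedPrefix k n = boundedPrefix l n := by
  ext x
  exact forall₂_congr fun i hi => by rw [h i hi]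

theorem boundedPrefix_eq_iUnion (k : ℕ → ℕ) (n : ℕ) :
    boundedPrefix k n = ⋃ m, boundedPrefix (Function.update k n m) (n + 1) := by
  ext x
  simp only [boundedPrefix, Set.mem_ofPred_eq, Set.mem_iUnion]
  constructor
  · intro h
    refine ⟨x n, fun i hi => ?_⟩
    rcases Nat.lt_succ_iff_lt_or_eq.1 hi with hi | rfl
    · rw [Function.update_of_ne hi.ne]; exact h i hi
    · simp
  · rintro ⟨m, h⟩ i hi
    have := h i (by omega)
    rwa [Function.update_of_ne hi.ne] at this

/-- The bounds are chosen one coordinate at a time, by continuity from below of the outer measure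
along arbitrary (not necessarily measurable) sets. -/
theorem exists_lt_measure_boundedPrefix {X : Type*} [MeasurableSpace X] (μ : Measure X)
    (f : (ℕ → ℕ) → X) {c : ℝ≥0∞} (hc : c < μ (Set.range f)) :
    ∃ k : ℕ → ℕ, ∀ n, c < μ (f '' boundedPrefix k n) := by
  have step : ∀ n (k : ℕ → ℕ), c < μ (f '' boundedPrefix k n) →
      ∃ m, c < μ (f '' boundedPrefix (Function.update k n m) (n + 1)) := by
    intro n k h
    rw [boundedPrefix_eq_iUnion, Set.image_iUnion, Monotone.measure_iUnion] at h
    · exact lt_iSup_iff.1 h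
    · intro a b hab
      refine Set.image_mono fun x hx i hi => (hx i hi).trans ?_
      exact Function.update_mono hab i
  choose! m hm using step
  let g : ℕ → ℕ → ℕ := fun n => Nat.rec (fun _ => 0) (fun n k => Function.update k n (m n k)) n
  have hg : ∀ n, c < μ (f '' boundedPrefix (g n) n) := by
    intro n
    induction n with
    | zero => simpa [boundedPrefix] using hc
    | succ n ih => exact hm n (g n) ih
  have hstab : ∀ d i, g (i + 1 + d) i = g (i + 1) i := by
    intro d i
    induction d with
    | zero => rfl
    | succ d ih =>
      rw [← ih]
      exact Function.update_of_ne (show i ≠ i + 1 + d by omega) _ _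
  refine ⟨fun i => g (i + 1) i, fun n => ?_⟩
  rw [boundedPrefix_congr (l := g n)]
  · exact hg n
  · intro i hi
    obtain ⟨d, rfl⟩ := Nat.exists_eq_add_of_le (show i + 1 ≤ n from hi)
    exact (hstab d i).symm

theorem isCompact_setOf_forall_le (k : ℕ → ℕ) : IsCompact {x : ℕ → ℕ | ∀ i, x i ≤ k i} := by
  have := isCompact_univ_pi (X := fun _ : ℕ => ℕ) (s := fun i => Set.Iic (k i))
    fun i => (Set.finite_Iic (k i)).isCompact
  convert this using 1
  ext x
  simp [Pi.le_def]

/-- Every open set that contains the compact box below `k` already contains the sequences that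
satisfy finitely many of its constraints. -/
theorem exists_boundedPrefix_subset {k : ℕ → ℕ} {U : Set (ℕ → ℕ)} (hU : IsOpen U)
    (hk : {x : ℕ → ℕ | ∀ i, x i ≤ k i} ⊆ U) : ∃ n, boundedPrefix k n ⊆ U := by
  have hcyl : ∀ x ∈ {x : ℕ → ℕ | ∀ i, x i ≤ k i}, ∃ n, PiNat.cylinder x n ⊆ U := by
    intro x hx
    obtain ⟨v, ⟨y, n, rfl⟩, hxv, hvU⟩ :=
      (PiNat.isTopologicalBasis_cylinders (fun _ : ℕ => ℕ)).exists_subset_of_mem_open (hk hx) hU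
    refine ⟨n, ?_⟩
    rwa [PiNat.mem_cylinder_iff_eq.1 hxv]
  choose! N hN using hcyl
  obtain ⟨t, ht, htc⟩ := (isCompact_setOf_forall_le k).elim_nhds_subcover
    (fun x => PiNat.cylinder x (N x))
    (fun x _ => (PiNat.isOpen_cylinder (fun _ : ℕ => ℕ) x (N x)).mem_nhds
      (PiNat.self_mem_cylinder x _))
  refine ⟨t.sup N, fun z hz => ?_⟩
  have hz' : (fun i => min (z i) (k i)) ∈ {x : ℕ → ℕ | ∀ i, x i ≤ k i} := fun i => min_le_right _ _
  obtain ⟨x, hxt, hx⟩ := Set.mem_iUnion₂.1 (htc hz')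
  refine hN x (ht x hxt) fun i hi => ?_
  have h1 := hx i hi
  have h2 : i < t.sup N := hi.trans_le (Finset.le_sup hxt)
  simpa [min_eq_left (hz i h2)] using h1

/-- Inner regularity of analytic sets: the compact set is the image of a box of sequences. -/
theorem exists_isCompact_le_measure {X : Type*} [TopologicalSpace X]
    [MeasurableSpace X] (μ : Measure X) [μ.OuterRegular] {f : (ℕ → ℕ) → X} (hf : Continuous f)
    {c : ℝ≥0∞} (hc : c < μ (Set.range f)) : ∃ K ⊆ Set.range f, IsCompact K ∧ c ≤ μ K := by
  obtain ⟨k, hk⟩ := exists_lt_measure_boundedPrefix μ f hc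
  refine ⟨f '' {x | ∀ i, x i ≤ k i}, Set.image_subset_range _ _,
    (isCompact_setOf_forall_le k).image hf, ?_⟩
  rw [Set.measure_eq_iInf_isOpen]
  refine le_iInf₂ fun U hKU => le_iInf fun hU => ?_
  obtain ⟨n, hn⟩ := exists_boundedPrefix_subset (hU.preimage hf) (Set.image_subset_iff.1 hKU)
  exact (hk n).le.trans (measure_mono (Set.image_subset_iff.2 hn))

theorem nullMeasurableSet_of_analyticSet {X : Type*} [TopologicalSpace X] [T2Space X]
    [MeasurableSpace X] [BorelSpace X] {s : Set X} (hs : AnalyticSet s) (μ : Measure X)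
    [IsFiniteMeasure μ] [μ.OuterRegular] : NullMeasurableSet s μ := by
  rw [AnalyticSet] at hs
  rcases hs with rfl | ⟨f, hf, rfl⟩
  · exact MeasurableSet.empty.nullMeasurableSet
  rcases eq_or_ne (μ (Set.range f)) 0 with h0 | h0
  · exact NullMeasurableSet.of_null h0
  obtain ⟨c, -, hc, hlim⟩ := exists_seq_strictMono_tendsto' (pos_iff_ne_zero.2 h0)
  choose K hKs hKc hK using fun n => exists_isCompact_le_measure μ hf (hc n).2
  have hm : MeasurableSet (⋃ n, K n) := .iUnion fun n => (hKc n).measurableSet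
  have hsub : ⋃ n, K n ⊆ Set.range f := Set.iUnion_subset hKs
  have hle : μ (Set.range f) ≤ μ (⋃ n, K n) :=
    le_of_tendsto' hlim fun n => (hK n).trans (measure_mono (Set.subset_iUnion _ _))
  have hae : (⋃ n, K n : Set X) =ᵐ[μ] Set.range f := 
    ae_eq_of_subset_of_measure_ge hsub hle hm.nullMeasurableSet (measure_ne_top _ _)
  exact hm.nullMeasurableSet.congr hae

/-! ### Memorylessness of the waiting times -/

theorem expMeasure_Ioi {x : ℝ} (hx : 0 ≤ x) :
    expMeasure 1 (Set.Ioi x) = ENNReal.ofReal (Real.exp (-x)) := by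
  have : IsProbabilityMeasure (expMeasure 1) := isProbabilityMeasure_expMeasure one_pos
  have h := cdf_expMeasure_eq one_pos x
  rw [if_pos hx, cdf_eq_real, one_mul] at h
  rw [← Set.compl_Iic, ← ofReal_measureReal, measureReal_compl measurableSet_Iic, h]
  simp

theorem expMeasure_Ioi_of_nonpos {x : ℝ} (hx : x ≤ 0) : expMeasure 1 (Set.Ioi x) = 1 := by
  have : IsProbabilityMeasure (expMeasure 1) := isProbabilityMeasure_expMeasure one_pos
  refine le_antisymm prob_le_one ?_
  calc (1 : ℝ≥0∞) = expMeasure 1 (Set.Ioi 0) := by simp [expMeasure_Ioi le_rfl]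
    _ ≤ _ := measure_mono (Set.Ioi_subset_Ioi hx)

/-- Memorylessness: beyond `u`, the exponential law is a multiple of its translate by `u`. -/
theorem expMeasure_restrict_Ioi {u : ℝ} (hu : 0 ≤ u) :
    (expMeasure 1).restrict (Set.Ioi u) =
      expMeasure 1 (Set.Ioi u) • (expMeasure 1).map (fun b => u + b) := by
  have : IsProbabilityMeasure (expMeasure 1) := isProbabilityMeasure_expMeasure one_pos
  have hmap : ∀ a, (expMeasure 1).map (fun b => u + b) (Set.Ioi a) =
      expMeasure 1 (Set.Ioi (a - u)) := fun a => by
    rw [Measure.map_apply (by fun_prop) measurableSet_Ioi, Set.preimage_const_add_Ioi]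
  refine ext_of_generate_finite _ (borel_eq_generateFrom_Ioi ℝ ▸ BorelSpace.measurable_eq)
    isPiSystem_Ioi ?_ ?_
  · rintro _ ⟨a, rfl⟩
    rw [Measure.restrict_apply measurableSet_Ioi, Set.Ioi_inter_Ioi, Measure.smul_apply, hmap,
      smul_eq_mul]
    rcases le_total a u with h | h
    · rw [sup_eq_right.2 h, expMeasure_Ioi_of_nonpos (sub_nonpos.2 h), mul_one]
    · rw [sup_eq_left.2 h, expMeasure_Ioi hu, expMeasure_Ioi (sub_nonneg.2 h),
        expMeasure_Ioi (hu.trans h), ← ENNReal.ofReal_mul (Real.exp_nonneg _), ← Real.exp_add]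
      congr 2
      ring
  · rw [Measure.smul_apply, Measure.map_apply (by fun_prop) .univ]
    simp

theorem measurableSet_fst_gt (u : ℝ) : MeasurableSet {a : ℝ × ℝ | u < a.1} :=
  measurableSet_lt measurable_const measurable_fst

theorem ringLaw_memoryless {u : ℝ} (hu : 0 ≤ u) {t : Set (ℝ × ℝ)} (ht : MeasurableSet t) :
    ringLaw (t ∩ {a | u < a.1}) =
      ringLaw {a | u < a.1} * ringLaw {b | (u + b.1, b.2) ∈ t} := by
  have : IsProbabilityMeasure (expMeasure 1) := isProbabilityMeasure_expMeasure one_pos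
  have hp : IsProbabilityMeasure (volume.restrict (Set.Icc (0 : ℝ) 1)) := ⟨by simp⟩
  have hset : {a : ℝ × ℝ | u < a.1} = Set.Ioi u ×ˢ Set.univ := by ext; simp
  have hmap : (ringLaw.map fun b => (u + b.1, b.2)) =
      ((expMeasure 1).map (fun b => u + b)).prod (volume.restrict (Set.Icc (0 : ℝ) 1)) := by
    have := Measure.map_prod_map (expMeasure 1) (volume.restrict (Set.Icc (0 : ℝ) 1))
      (f := fun b => u + b) (g := id) (by fun_prop) measurable_id
    rw [Measure.map_id] at this
    rw [this]
    rfl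
  have hres : ringLaw.restrict {a | u < a.1} =
      ringLaw {a | u < a.1} • ringLaw.map fun b => (u + b.1, b.2) := by
    rw [hmap, hset, ringLaw, Measure.prod_prod, measure_univ, mul_one, ← Measure.prod_restrict,
      Measure.restrict_univ, expMeasure_restrict_Ioi hu, Measure.prod_smul_left]
  rw [← Measure.restrict_apply ht, hres, Measure.smul_apply, smul_eq_mul,
    Measure.map_apply (by fun_prop) ht]
  rfl

/-! ### Restarting one clock -/

/-- The law of the noise at one site. -/
noncomputable def siteLaw : Measure (ℕ → ℝ × ℝ) := Measure.infinitePi fun _ => ringLaw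

instance : IsProbabilityMeasure siteLaw := by
  unfold siteLaw
  infer_instance

/-- The sequence with first term `a` and further terms `x`. -/
def consSeq (a : ℝ × ℝ) (x : ℕ → ℝ × ℝ) : ℕ → ℝ × ℝ
  | 0 => a
  | k + 1 => x k

theorem measurable_consSeq : Measurable fun p : (ℝ × ℝ) × (ℕ → ℝ × ℝ) => consSeq p.1 p.2 := by
  refine measurable_pi_iff.2 fun k => ?_
  cases k with
  | zero => exact measurable_fst
  | succ k => exact (measurable_pi_apply k).comp measurable_snd

/-- To identify a measure on sequences with a product measure it is enough to check boxes in an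
initial segment of coordinates. -/
theorem eq_infinitePi_of_range {X : Type*} [MeasurableSpace X] {μ : Measure X}
    [IsProbabilityMeasure μ] {ν : Measure (ℕ → X)}
    (h : ∀ (n : ℕ) (t : ℕ → Set X), (∀ i, MeasurableSet (t i)) →
      ν {x | ∀ i < n, x i ∈ t i} = ∏ i ∈ Finset.range n, μ (t i)) :
    ν = Measure.infinitePi fun _ => μ := by
  classical
  refine Measure.eq_infinitePi _ fun s t ht => ?_
  obtain ⟨n, hn⟩ := s.exists_nat_subset_range
  have := h n (fun i => if i ∈ s then t i else Set.univ)
    (fun i => by split_ifs; exacts [ht i, .univ])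
  have hset : {x : ℕ → X | ∀ i < n, x i ∈ if i ∈ s then t i else Set.univ} = Set.pi s t := by
    ext x
    constructor
    · intro hx i hi
      have := hx i (Finset.mem_range.1 (hn hi))
      rwa [if_pos (Finset.mem_coe.1 hi)] at this
    · intro hx i _
      split_ifs with his
      exacts [hx i his, trivial]
  rw [hset] at this
  rw [this, ← Finset.prod_subset hn]
  · exact Finset.prod_congr rfl fun i hi => by rw [if_pos hi]
  · intro i _ hi
    rw [if_neg hi, measure_univ]

theorem siteLaw_range (n : ℕ) {t : ℕ → Set (ℝ × ℝ)} (ht : ∀ i, MeasurableSet (t i)) :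
    siteLaw {x | ∀ i < n, x i ∈ t i} = ∏ i ∈ Finset.range n, ringLaw (t i) := by
  rw [siteLaw, ← Measure.infinitePi_pi _ fun i _ => ht i]
  congr 1
  ext x
  simp

theorem measurableSet_box {X : Type*} [MeasurableSpace X] (n : ℕ) {t : ℕ → Set X}
    (ht : ∀ i, MeasurableSet (t i)) : MeasurableSet {x : ℕ → X | ∀ i < n, x i ∈ t i} := by
  simp only [Set.ofPred_forall]
  exact .iInter fun i => .iInter fun _ => measurable_pi_apply i (ht i)

theorem siteLaw_eq_map_consSeq :
    (ringLaw.prod siteLaw).map (fun p => consSeq p.1 p.2) = siteLaw := by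
  refine eq_infinitePi_of_range fun n t ht => ?_
  rw [Measure.map_apply measurable_consSeq (measurableSet_box n ht)]
  cases n with
  | zero => simp
  | succ n =>
    have : (fun p : (ℝ × ℝ) × (ℕ → ℝ × ℝ) => consSeq p.1 p.2) ⁻¹'
        {x | ∀ i < n + 1, x i ∈ t i} = t 0 ×ˢ {x | ∀ i < n, x i ∈ t (i + 1)} := by
      ext p
      simp only [Set.mem_preimage, Set.mem_ofPred_eq, Set.mem_prod]
      constructor
      · intro h
        exact ⟨h 0 (by omega), fun i hi => h (i + 1) (by omega)⟩
      · rintro ⟨h0, h⟩ i hi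
        cases i with
        | zero => exact h0
        | succ i => exact h i (by omega)
    rw [this, Measure.prod_prod, siteLaw_range n fun i => ht (i + 1), Finset.prod_range_succ',
      mul_comm]

/-- The noise at one site that agrees with `x` up to time `u` and continues with `y` afterwards: the
rings of `x` after time `u` are discarded, and the clock of `y` is started at time `u`. -/
noncomputable def splice (u : ℝ) (x y : ℕ → ℝ × ℝ) : ℕ → ℝ × ℝ
  | 0 => if (x 0).1 ≤ u then x 0 else (u + (y 0).1, (y 0).2)
  | k + 1 => if (x 0).1 ≤ u then splice (u - (x 0).1) (fun j => x (j + 1)) y k else y (k + 1)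

theorem measurable_splice :
    Measurable fun p : ℝ × (ℕ → ℝ × ℝ) × (ℕ → ℝ × ℝ) => splice p.1 p.2.1 p.2.2 := by
  refine measurable_pi_iff.2 fun k => ?_
  induction k with
  | zero =>
    simp only [splice]
    refine Measurable.ite (measurableSet_le ?_ ?_) ?_ ?_ <;> fun_prop
  | succ k ih =>
    simp only [splice]
    refine Measurable.ite (measurableSet_le (by fun_prop) (by fun_prop)) ?_ (by fun_prop)
    exact ih.comp (g := fun p : ℝ × (ℕ → ℝ × ℝ) × (ℕ → ℝ × ℝ) =>
      splice p.1 p.2.1 p.2.2 k) (f := fun p : ℝ × (ℕ → ℝ × ℝ) × (ℕ → ℝ × ℝ) =>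
        (p.1 - (p.2.1 0).1, (fun j => p.2.1 (j + 1)), p.2.2)) (by fun_prop)

/-- Induction on the number of coordinates, conditioning on the first ring of `x`: if it comes
before time `u`, the rest is a splice at the remaining time; if not, memorylessness replaces it by
the first ring of `y` shifted by `u`. -/
theorem siteLaw_prod_splice_range (n : ℕ) : ∀ {u : ℝ}, 0 ≤ u → ∀ {t : ℕ → Set (ℝ × ℝ)},
    (∀ i, MeasurableSet (t i)) →
    (siteLaw.prod siteLaw) {p | ∀ i < n, splice u p.1 p.2 i ∈ t i} =
      ∏ i ∈ Finset.range n, ringLaw (t i) := by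
  induction n with
  | zero => intro u _ t _; simp
  | succ n ih =>
    intro u hu t ht
    set q₀ := ∏ i ∈ Finset.range n, ringLaw (t (i + 1)) with hq
    have hmeas : MeasurableSet {p : (ℕ → ℝ × ℝ) × (ℕ → ℝ × ℝ) |
        ∀ i < n + 1, splice u p.1 p.2 i ∈ t i} :=
      (measurable_splice.comp (f := fun p : (ℕ → ℝ × ℝ) × (ℕ → ℝ × ℝ) => (u, p.1, p.2))
        (by fun_prop)) (measurableSet_box (n + 1) ht)
    have hcons : Measurable fun q : (ℝ × ℝ) × (ℕ → ℝ × ℝ) × (ℕ → ℝ × ℝ) =>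
        (consSeq q.1 q.2.1, q.2.2) :=
      (measurable_consSeq.comp (f := fun q : (ℝ × ℝ) × (ℕ → ℝ × ℝ) × (ℕ → ℝ × ℝ) =>
        (q.1, q.2.1)) (by fun_prop)).prodMk (by fun_prop)
    have hlaw : siteLaw.prod siteLaw = (ringLaw.prod (siteLaw.prod siteLaw)).map
        fun q => (consSeq q.1 q.2.1, q.2.2) := by
      have h1 := Measure.map_prod_map (ringLaw.prod siteLaw) siteLaw
        measurable_consSeq measurable_id
      rw [siteLaw_eq_map_consSeq, Measure.map_id] at h1
      have h2 : ((ringLaw.prod siteLaw).prod siteLaw).map MeasurableEquiv.prodAssoc =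
        ringLaw.prod (siteLaw.prod siteLaw) := Measure.prodAssoc_prod
      rw [← h2, Measure.map_map hcons (MeasurableEquiv.measurable _), h1]
      rfl
    rw [hlaw, Measure.map_apply hcons hmeas, Measure.prod_apply (hcons hmeas)]
    have hin : ∀ a : ℝ × ℝ, (siteLaw.prod siteLaw) (Prod.mk a ⁻¹'
        ((fun q : (ℝ × ℝ) × (ℕ → ℝ × ℝ) × (ℕ → ℝ × ℝ) => (consSeq q.1 q.2.1, q.2.2)) ⁻¹'
          {p | ∀ i < n + 1, splice u p.1 p.2 i ∈ t i})) =
        (t 0 ∩ {a | u < a.1}ᶜ).indicator (fun _ => q₀) a +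
        {a : ℝ × ℝ | u < a.1}.indicator
          (fun _ => ringLaw {b | (u + b.1, b.2) ∈ t 0} * q₀) a := by
      intro a
      rcases le_or_gt a.1 u with ha | ha
      · have hset : Prod.mk a ⁻¹'
            ((fun q : (ℝ × ℝ) × (ℕ → ℝ × ℝ) × (ℕ → ℝ × ℝ) => (consSeq q.1 q.2.1, q.2.2)) ⁻¹'
            {p | ∀ i < n + 1, splice u p.1 p.2 i ∈ t i}) =
            {p | a ∈ t 0 ∧ ∀ i < n, splice (u - a.1) p.1 p.2 i ∈ t (i + 1)} := by
          ext p
          simp only [Set.mem_preimage, Set.mem_ofPred_eq]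
          constructor
          · intro h
            refine ⟨?_, fun i hi => ?_⟩
            · simpa [splice, consSeq, ha] using h 0 (by omega)
            · simpa [splice, consSeq, ha] using h (i + 1) (by omega)
          · rintro ⟨h0, h⟩ i hi
            cases i with
            | zero => simpa [splice, consSeq, ha] using h0
            | succ i => simpa [splice, consSeq, ha] using h i (by omega)
        rw [hset, Set.indicator_of_notMem (s := {a : ℝ × ℝ | u < a.1}) (not_lt.2 ha), add_zero]
        by_cases h0 : a ∈ t 0
        · rw [Set.indicator_of_mem (show a ∈ t 0 ∩ {a | u < a.1}ᶜ from ⟨h0, not_lt.2 ha⟩)]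
          simp only [h0, true_and]
          exact ih (sub_nonneg.2 ha) fun i => ht (i + 1)
        · rw [Set.indicator_of_notMem fun h => h0 h.1]
          simp [h0]
      · have hshift : Measurable fun b : ℝ × ℝ => (u + b.1, b.2) := by fun_prop
        have hset : Prod.mk a ⁻¹'
            ((fun q : (ℝ × ℝ) × (ℕ → ℝ × ℝ) × (ℕ → ℝ × ℝ) => (consSeq q.1 q.2.1, q.2.2)) ⁻¹'
            {p | ∀ i < n + 1, splice u p.1 p.2 i ∈ t i}) =
            Set.univ ×ˢ {y | ∀ i < n + 1,
              y i ∈ Function.update t 0 ((fun b => (u + b.1, b.2)) ⁻¹' t 0) i} := by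
          ext p
          simp only [Set.mem_preimage, Set.mem_ofPred_eq, Set.mem_prod, Set.mem_univ, true_and]
          refine forall₂_congr fun i hi => ?_
          cases i with
          | zero => simp [splice, consSeq, not_le.2 ha]
          | succ i => simp [splice, consSeq, not_le.2 ha]
        have hmeas' : ∀ i, MeasurableSet
            (Function.update t 0 ((fun b => (u + b.1, b.2)) ⁻¹' t 0) i) := by
          intro i
          cases i with
          | zero => simpa using hshift (ht 0)
          | succ i => simpa using ht (i + 1)
        rw [hset, Measure.prod_prod, measure_univ, one_mul, siteLaw_range _ hmeas',
          Finset.prod_range_succ', Set.indicator_of_notMem fun h => h.2 ha,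
          Set.indicator_of_mem (show a ∈ {a : ℝ × ℝ | u < a.1} from ha), zero_add, mul_comm]
        simp [hq, Set.preimage]
    have hgt := measurableSet_fst_gt u
    simp_rw [hin]
    rw [lintegral_add_right _ (measurable_const.indicator hgt),
      lintegral_indicator ((ht 0).inter hgt.compl), lintegral_indicator hgt,
      setLIntegral_const, setLIntegral_const, Finset.prod_range_succ', ← hq,
      mul_right_comm, mul_comm (ringLaw _) (ringLaw {a | u < a.1}),
      ← ringLaw_memoryless hu (ht 0), mul_comm q₀, ← add_mul, ← Set.sdiff_eq,
      add_comm, measure_inter_add_sdiff _ hgt, mul_comm]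

/-- The Markov property of one clock at a fixed time `u`. -/
theorem map_splice {u : ℝ} (hu : 0 ≤ u) :
    (siteLaw.prod siteLaw).map (fun p => splice u p.1 p.2) = siteLaw := by
  have hs : Measurable fun p : (ℕ → ℝ × ℝ) × (ℕ → ℝ × ℝ) => splice u p.1 p.2 :=
    measurable_splice.comp (f := fun p : (ℕ → ℝ × ℝ) × (ℕ → ℝ × ℝ) => (u, p.1, p.2))
      (by fun_prop)
  refine eq_infinitePi_of_range fun n t ht => ?_
  rw [Measure.map_apply hs (measurableSet_box n ht)]
  exact siteLaw_prod_splice_range n hu ht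

/-! ### Restarting the noise -/

/-- Pairs of independent families, each with independent components, form an independent family of
pairs. -/
theorem infinitePi_prod_infinitePi_map {ι X Y : Type*} [MeasurableSpace X] [MeasurableSpace Y]
    {μ : Measure X} [IsProbabilityMeasure μ] {f : X × X → Y} (hf : Measurable f) :
    ((Measure.infinitePi fun _ : ι => μ).prod (Measure.infinitePi fun _ : ι => μ)).map
      (fun p i => f (p.1 i, p.2 i)) = Measure.infinitePi fun _ : ι => (μ.prod μ).map f := by
  have hne : true ≠ false := by decide
  have hf2 : Measurable fun (p : (ι → X) × (ι → X)) (i : ι) => f (p.1 i, p.2 i) :=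
    measurable_pi_iff.2 fun i => hf.comp (by fun_prop)
  have hf3 : Measurable fun (ω : ι → Bool → X) (i : ι) => f (ω i true, ω i false) :=
    measurable_pi_iff.2 fun i => hf.comp (by fun_prop)
  -- Both sides are images of one product measure, indexed by `ι × Bool`.
  have hA : (Measure.infinitePi fun _ : ι => μ).prod (Measure.infinitePi fun _ : ι => μ) =
      (Measure.infinitePi fun _ : ι × Bool => μ).map
        fun ω => (fun i => ω (i, true), fun i => ω (i, false)) := by
    rw [← Measure.infinitePi_map_eval_prod (P := fun _ : Bool => Measure.infinitePi fun _ : ι => μ)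
      hne, ← Measure.infinitePi_map_curry (fun (_ : Bool) (_ : ι) => μ),
      ← Measure.map_infinitePi_infinitePi_of_inj (P := fun _ : ι × Bool => μ)
        (f := (Prod.swap : Bool × ι → ι × Bool)) Prod.swap_injective,
      Measure.map_map (by fun_prop) (by fun_prop), Measure.map_map (by fun_prop) (by fun_prop)]
    rfl
  have hB : Measure.infinitePi (fun _ : ι => (μ.prod μ).map f) =
      (Measure.infinitePi fun _ : ι × Bool => μ).map
        fun ω i => f (ω (i, true), ω (i, false)) := by
    have : (μ.prod μ).map f = (Measure.infinitePi fun _ : Bool => μ).map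
        fun ω => f (ω true, ω false) := by
      rw [← Measure.infinitePi_map_eval_prod (P := fun _ : Bool => μ) hne,
        Measure.map_map hf (by fun_prop)]
      rfl
    simp_rw [this]
    rw [← Measure.infinitePi_map_pi (fun _ : ι => Measure.infinitePi fun _ : Bool => μ)
      (f := fun _ ω => f (ω true, ω false)) (fun _ => hf.comp (by fun_prop)),
      ← Measure.infinitePi_map_curry (fun (_ : ι) (_ : Bool) => μ),
      Measure.map_map hf3 (by fun_prop)]
    rfl
  rw [hA, hB, Measure.map_map hf2 (by fun_prop)]
  rfl

/-- The noise that agrees with `x` up to time `u` and continues with `y` afterwards. -/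
noncomputable def spliceNoise (u : ℝ) (x y : Noise) : Noise := fun p =>
  splice u (fun k => x (p.1, k)) (fun k => y (p.1, k)) p.2

theorem measurable_spliceNoise (u : ℝ) :
    Measurable fun p : Noise × Noise => spliceNoise u p.1 p.2 := by
  refine measurable_pi_iff.2 fun q => (measurable_pi_apply q.2).comp ?_
  exact measurable_splice.comp (f := fun p : Noise × Noise =>
    (u, (fun k => p.1 (q.1, k)), fun k => p.2 (q.1, k))) (by fun_prop)

/-- The Markov property of the noise: when the noise after time `u` is replaced by an independent
copy started at time `u`, the law does not change. -/
theorem measurePreserving_spliceNoise {u : ℝ} (hu : 0 ≤ u) :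
    MeasurePreserving (fun p : Noise × Noise => spliceNoise u p.1 p.2)
      (noiseLaw.prod noiseLaw) noiseLaw := by
  refine ⟨measurable_spliceNoise u, ?_⟩
  have hs : Measurable fun p : (ℕ → ℝ × ℝ) × (ℕ → ℝ × ℝ) => splice u p.1 p.2 :=
    measurable_splice.comp (f := fun p : (ℕ → ℝ × ℝ) × (ℕ → ℝ × ℝ) => (u, p.1, p.2))
      (by fun_prop)
  have hs2 : Measurable fun (p : (Site → ℕ → ℝ × ℝ) × (Site → ℕ → ℝ × ℝ)) (i : Site) =>
      splice u (p.1 i) (p.2 i) :=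
    measurable_pi_iff.2 fun i => hs.comp (f := fun p : (Site → ℕ → ℝ × ℝ) × (Site → ℕ → ℝ × ℝ) =>
      (p.1 i, p.2 i)) (by fun_prop)
  have hcurry : noiseLaw.map (MeasurableEquiv.curry Site ℕ (ℝ × ℝ)) =
      Measure.infinitePi fun _ : Site => siteLaw :=
    Measure.infinitePi_map_curry (fun (_ : Site) (_ : ℕ) => ringLaw)
  have h := infinitePi_prod_infinitePi_map (ι := Site) (μ := siteLaw) hs
  rw [map_splice hu, ← hcurry, Measure.map_prod_map _ _ (by fun_prop) (by fun_prop),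
    Measure.map_map hs2 (by fun_prop)] at h
  refine (MeasurableEquiv.curry Site ℕ (ℝ × ℝ)).map_measurableEquiv_injective ?_
  rw [← h, Measure.map_map (by fun_prop) (measurable_spliceNoise u)]
  rfl

/-! ### Clocks -/

/-- All waiting times are positive and no clock rings infinitely often in bounded time. -/
structure RegularClocks (w : Noise) : Prop where
  pos : ∀ p, 0 < (w p).1
  tendsto : ∀ i, Tendsto (ringTime w i) atTop atTop

theorem ringTime_succ (w : Noise) (i : Site) (k : ℕ) :
    ringTime w i (k + 1) = ringTime w i k + (w (i, k + 1)).1 :=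
  Finset.sum_range_succ _ _

theorem ringTime_zero (w : Noise) (i : Site) : ringTime w i 0 = (w (i, 0)).1 := by
  simp [ringTime]

theorem RegularClocks.strictMono {w : Noise} (h : RegularClocks w) (i : Site) :
    StrictMono (ringTime w i) :=
  strictMono_nat_of_lt_succ fun k => by
    rw [ringTime_succ]
    exact lt_add_of_pos_right _ (h.pos _)

theorem RegularClocks.ringTime_pos {w : Noise} (h : RegularClocks w) (i : Site) (k : ℕ) :
    0 < ringTime w i k :=
  Finset.sum_pos (fun _ _ => h.pos _) (by simp)

/-- The cardinality of a proper initial segment of `ℕ` is its least non-member. -/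
theorem lt_ncard_iff {p : ℕ → Prop} (hp : ∀ {k l}, k ≤ l → p l → p k) (hf : ∃ k, ¬ p k) (k : ℕ) :
    k < {k | p k}.ncard ↔ p k := by
  classical
  have hset : {k | p k} = Set.Iio (Nat.find hf) := by
    ext k
    simp only [Set.mem_ofPred_eq, Set.mem_Iio, Nat.lt_find_iff, not_not]
    exact ⟨fun hk l hl => hp hl hk, fun hk => hk k le_rfl⟩
  have hcard : {k | p k}.ncard = Nat.find hf := by
    rw [hset, ← Finset.coe_Iio, Set.ncard_coe_finset, Nat.card_Iio]
  rw [hcard]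
  exact (Set.ext_iff.1 hset k).symm

theorem RegularClocks.lt_ringsUpTo_iff {w : Noise} (h : RegularClocks w) {i : Site} {s : ℝ}
    {k : ℕ} : k < ringsUpTo w i s ↔ ringTime w i k ≤ s :=
  lt_ncard_iff (fun hkl hl => ((h.strictMono i).monotone hkl).trans hl)
    (((h.tendsto i).eventually_gt_atTop s).exists.imp fun _ => not_le.2) k

theorem RegularClocks.lt_ringsBefore_iff {w : Noise} (h : RegularClocks w) {i : Site} {s : ℝ}
    {k : ℕ} : k < ringsBefore w i s ↔ ringTime w i k < s :=
  lt_ncard_iff (fun hkl hl => ((h.strictMono i).monotone hkl).trans_lt hl)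
    (((h.tendsto i).eventually_ge_atTop s).exists.imp fun _ => not_lt.2) k

/-- If `n` is the number of rings of `x` up to time `u`, the splice consists of the first `n`
terms of `x`, followed by `y` with its first waiting time prolonged by the time from ring `n - 1`
of `x` to `u`. -/
theorem splice_spec (y : ℕ → ℝ × ℝ) : ∀ (n : ℕ) (u : ℝ) (x : ℕ → ℝ × ℝ),
    (∀ k < n, ∑ j ∈ Finset.range (k + 1), (x j).1 ≤ u) →
    u < ∑ j ∈ Finset.range (n + 1), (x j).1 →
    (∀ k < n, splice u x y k = x k) ∧
      splice u x y n = (u - ∑ j ∈ Finset.range n, (x j).1 + (y 0).1, (y 0).2) ∧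
      ∀ m, splice u x y (n + m + 1) = y (m + 1)
  | 0, u, x, _, h => by
    have h0 : ¬ (x 0).1 ≤ u := by simpa using h
    refine ⟨by simp, by simp [splice, h0], fun m => by simp [splice, h0]⟩
  | n + 1, u, x, hle, h => by
    have h0 : (x 0).1 ≤ u := by simpa using hle 0 (by omega)
    obtain ⟨h1, h2, h3⟩ := splice_spec y n (u - (x 0).1) (fun j => x (j + 1))
      (fun k hk => by
        have := hle (k + 1) (by omega)
        rw [Finset.sum_range_succ'] at this
        linarith)
      (by rw [Finset.sum_range_succ'] at h; linarith)
    refine ⟨fun k hk => ?_, ?_, fun m => ?_⟩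
    · cases k with
      | zero => simp [splice, h0]
      | succ k => simpa [splice, h0] using h1 k (by omega)
    · simp only [splice, h0, if_true, h2]
      rw [Finset.sum_range_succ', sub_sub, add_comm (x 0).1]
    · rw [show n + 1 + m + 1 = n + m + 1 + 1 by omega]
      simpa [splice, h0] using h3 m

theorem RegularClocks.splice_spec {x : Noise} (h : RegularClocks x) (u : ℝ) (y : Noise) (i : Site) :
    (∀ k < ringsUpTo x i u, spliceNoise u x y (i, k) = x (i, k)) ∧
      spliceNoise u x y (i, ringsUpTo x i u) =
        (u - ∑ j ∈ Finset.range (ringsUpTo x i u), (x (i, j)).1 + (y (i, 0)).1, (y (i, 0)).2) ∧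
      ∀ m, spliceNoise u x y (i, ringsUpTo x i u + m + 1) = y (i, m + 1) :=
  IsingGlauber.splice_spec (fun k => y (i, k)) (ringsUpTo x i u) u (fun k => x (i, k))
    (fun _ hk => h.lt_ringsUpTo_iff.1 hk) (not_le.1 (mt h.lt_ringsUpTo_iff.2 (lt_irrefl _)))

theorem RegularClocks.ringTime_splice_of_lt {x : Noise} (h : RegularClocks x) {u : ℝ} (y : Noise)
    {i : Site} {k : ℕ} (hk : k < ringsUpTo x i u) :
    ringTime (spliceNoise u x y) i k = ringTime x i k := by
  refine Finset.sum_congr rfl fun j hj => ?_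
  rw [(h.splice_spec u y i).1 j (by rw [Finset.mem_range] at hj; omega)]

theorem RegularClocks.mark_splice_of_lt {x : Noise} (h : RegularClocks x) {u : ℝ} (y : Noise)
    {i : Site} {k : ℕ} (hk : k < ringsUpTo x i u) :
    mark (spliceNoise u x y) i k = mark x i k := by
  rw [mark, (h.splice_spec u y i).1 k hk, mark]

theorem RegularClocks.ringTime_splice_add {x : Noise} (h : RegularClocks x) (u : ℝ) (y : Noise)
    (i : Site) (m : ℕ) :
    ringTime (spliceNoise u x y) i (ringsUpTo x i u + m) = u + ringTime y i m := by
  obtain ⟨h1, h2, h3⟩ := h.splice_spec u y i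
  induction m with
  | zero =>
    rw [add_zero, ringTime, Finset.sum_range_succ, h2, ringTime_zero,
      Finset.sum_congr rfl fun j hj => by rw [h1 j (Finset.mem_range.1 hj)]]
    ring
  | succ m ih => rw [← add_assoc, ringTime_succ, ih, h3, ringTime_succ, add_assoc]

theorem RegularClocks.mark_splice_add {x : Noise} (h : RegularClocks x) (u : ℝ) (y : Noise)
    (i : Site) (m : ℕ) :
    mark (spliceNoise u x y) i (ringsUpTo x i u + m) = mark y i m := by
  obtain ⟨-, h2, h3⟩ := h.splice_spec u y i
  cases m with
  | zero => rw [mark, add_zero, h2, mark]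
  | succ m => rw [mark, ← add_assoc, h3, mark]

/-! ### Almost sure properties of the clocks -/

theorem ringLaw_fst_le {δ : ℝ} (hδ : 0 ≤ δ) : ringLaw {a | a.1 ≤ δ} ≤ ENNReal.ofReal δ := by
  have : IsProbabilityMeasure (expMeasure 1) := isProbabilityMeasure_expMeasure one_pos
  have hset : {a : ℝ × ℝ | a.1 ≤ δ} = Set.Iic δ ×ˢ Set.univ := by ext; simp
  have hp : (volume.restrict (Set.Icc (0 : ℝ) 1)) Set.univ = 1 := by simp
  have h := cdf_expMeasure_eq one_pos δ
  rw [if_pos hδ, cdf_eq_real, one_mul] at h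
  rw [hset, ringLaw, Measure.prod_prod, hp, mul_one, ← ofReal_measureReal, h]
  exact ENNReal.ofReal_le_ofReal (by linarith [Real.add_one_le_exp (-δ)])

theorem noiseLaw_forall_le (F : Finset (Site × ℕ)) {δ : ℝ} (hδ : 0 ≤ δ) :
    noiseLaw {w | ∀ p ∈ F, (w p).1 ≤ δ} ≤ ENNReal.ofReal δ ^ F.card := by
  have : {w : Noise | ∀ p ∈ F, (w p).1 ≤ δ} = Set.pi F fun _ => {a | a.1 ≤ δ} := by
    ext w; simp [Set.pi]
  rw [this, noiseLaw, Measure.infinitePi_pi _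
    fun _ _ => measurableSet_le measurable_fst measurable_const, Finset.prod_const]
  exact pow_le_pow_left' (ringLaw_fst_le hδ) _

theorem ae_regularClocks : ∀ᵐ w ∂noiseLaw, RegularClocks w := by
  have hpos : ∀ᵐ w ∂noiseLaw, ∀ p, 0 < (w p).1 := by
    refine ae_all_iff.2 fun p => ?_
    have := noiseLaw_forall_le {p} le_rfl
    simp only [Finset.mem_singleton, forall_eq, ENNReal.ofReal_zero, Finset.card_singleton,
      pow_one, nonpos_iff_eq_zero] at this
    rw [ae_iff]
    simpa using this
  -- Infinitely many long waits: `n` given waits are all short with probability at most `8⁻ⁿ`.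
  have hlong : ∀ᵐ w ∂noiseLaw, ∀ (i : Site) (k : ℕ), ∃ l ≥ k, 1 / 8 < (w (i, l)).1 := by
    refine ae_all_iff.2 fun i => ae_all_iff.2 fun k => ?_
    rw [ae_iff, ← nonpos_iff_eq_zero]
    have hlim : Tendsto (fun n : ℕ => ENNReal.ofReal (1 / 8) ^ n) atTop (𝓝 0) :=
      ENNReal.tendsto_pow_atTop_nhds_zero_of_lt_one
        (ENNReal.ofReal_lt_one.2 (by norm_num))
    refine ge_of_tendsto' hlim fun n => ?_
    have hinj : Function.Injective fun l : ℕ => (i, l) := fun _ _ h => (Prod.ext_iff.1 h).2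
    have := noiseLaw_forall_le ((Finset.Ico k (k + n)).map ⟨_, hinj⟩)
      (δ := 1 / 8) (by norm_num)
    rw [Finset.card_map, Nat.card_Ico, Nat.add_sub_cancel_left] at this
    refine (measure_mono fun w hw p hp => ?_).trans this
    obtain ⟨l, hl, rfl⟩ := Finset.mem_map.1 hp
    by_contra hcon
    exact hw ⟨l, (Finset.mem_Ico.1 hl).1, not_le.1 hcon⟩
  filter_upwards [hpos, hlong] with w hw hl
  have hmono : ∀ i, Monotone (ringTime w i) := fun i => monotone_nat_of_le_succ fun k => by
    rw [ringTime_succ]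
    exact le_add_of_nonneg_right (hw _).le
  refine ⟨hw, fun i => tendsto_atTop_atTop_of_monotone (hmono i) ?_⟩
  have key : ∀ n : ℕ, ∃ k, (n : ℝ) * (1 / 8) ≤ ringTime w i k := by
    intro n
    induction n with
    | zero => exact ⟨0, by simpa [ringTime_zero] using (hw _).le⟩
    | succ n ih =>
      obtain ⟨k, hk⟩ := ih
      obtain ⟨l, hl, h8⟩ := hl i (k + 1)
      obtain ⟨l, rfl⟩ := Nat.exists_eq_add_of_le hl
      refine ⟨k + l + 1, ?_⟩
      rw [show k + 1 + l = k + l + 1 by omega] at h8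
      rw [ringTime_succ]
      have := hmono i (show k ≤ k + l by omega)
      push_cast
      linarith
  intro b
  obtain ⟨n, hn⟩ := exists_nat_gt (b * 8)
  obtain ⟨k, hk⟩ := key n
  exact ⟨k, by linarith⟩

/-! ### Percolation of ringing sites in a short time window -/

/-- The nearest neighbours of a site. -/
def neighbors (i : Site) : List Site :=
  [(i.1 + 1, i.2), (i.1 - 1, i.2), (i.1, i.2 + 1), (i.1, i.2 - 1)]

/-- The nearest-neighbour walks with `n` steps from `i`, as lists of `n + 1` sites. -/
def walks : ℕ → Site → List (List Site)
  | 0, i => [[i]]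
  | n + 1, i => (neighbors i).flatMap fun j => (walks n j).map (i :: ·)

theorem length_walks (n : ℕ) (i : Site) : (walks n i).length = 4 ^ n := by
  induction n generalizing i with
  | zero => rfl
  | succ n ih => simp [walks, neighbors, ih, pow_succ]; ring

theorem length_of_mem_walks {n : ℕ} {i : Site} {l : List Site} (h : l ∈ walks n i) :
    l.length = n + 1 := by
  induction n generalizing i l with
  | zero => simp_all [walks]
  | succ n ih =>
    simp only [walks, List.mem_flatMap, List.mem_map] at h
    obtain ⟨j, _, l', hl', rfl⟩ := h
    simp [ih hl']

/-- In a walk that visits every site finitely often, arbitrarily long self-avoiding walks can be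
found, by jumping to the last visit of the current site before each step. -/
theorem exists_nodup_mem_walks (n : ℕ) : ∀ c : ℕ → Site, (∀ k, c (k + 1) ∈ neighbors (c k)) →
    (∀ s, {k | c k = s}.Finite) → ∃ l ∈ walks n (c 0), l.Nodup ∧ ∀ s ∈ l, ∃ k, c k = s := by
  induction n with
  | zero => exact fun c _ _ => ⟨[c 0], by simp [walks], by simp, by simp⟩
  | succ n ih =>
    intro c hc hfin
    obtain ⟨m, hm, hmax⟩ := (hfin (c 0)).exists_maximal ⟨0, rfl⟩
    have hm' : c m = c 0 := hm
    obtain ⟨l, hl, hnd, hvis⟩ := ih (fun k => c (m + 1 + k)) (fun k => hc (m + 1 + k))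
      fun s => (hfin s).preimage (f := fun k => m + 1 + k) fun _ _ _ _ h => by simpa using h
    refine ⟨c 0 :: l, ?_, List.nodup_cons.2 ⟨fun h0 => ?_, hnd⟩, ?_⟩
    · simp only [walks, List.mem_flatMap, List.mem_map]
      exact ⟨c (m + 1), hm' ▸ hc m, l, hl, rfl⟩
    · obtain ⟨k, hk⟩ := hvis _ h0
      have := hmax (show m + 1 + k ∈ {k | c k = c 0} from hk) (by omega)
      omega
    · intro s hs
      rcases List.mem_cons.1 hs with rfl | hs
      · exact ⟨0, rfl⟩
      · obtain ⟨k, hk⟩ := hvis s hs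
        exact ⟨_, hk⟩

/-- The clock at `s` rings in the time window `(a, a + 1/8]`. -/
def RingsIn (w : Noise) (a : ℝ) (s : Site) : Prop :=
  ∃ k, a < ringTime w s k ∧ ringTime w s k ≤ a + 1 / 8

theorem measurable_ringTime (i : Site) (k : ℕ) : Measurable fun w => ringTime w i k := by
  unfold ringTime
  fun_prop

theorem measurableSet_ringsIn (a : ℝ) (s : Site) : MeasurableSet {w | RingsIn w a s} := by
  simp only [RingsIn, Set.ofPred_exists]
  exact .iUnion fun k => (measurableSet_lt measurable_const (measurable_ringTime s k)).inter
    (measurableSet_le (measurable_ringTime s k) measurable_const)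

/-- A clock restarted at time `a` rings in `(a, a + 1/8]` only if its first waiting time is at most
`1/8`; these events are independent for different sites. -/
theorem noiseLaw_forall_ringsIn {a : ℝ} (ha : 0 ≤ a) {l : List Site} (hl : l.Nodup) :
    noiseLaw {w | ∀ s ∈ l, RingsIn w a s} ≤ ENNReal.ofReal (1 / 8) ^ l.length := by
  have hm : MeasurableSet {w | ∀ s ∈ l, RingsIn w a s} := by
    have : {w | ∀ s ∈ l, RingsIn w a s} = ⋂ s ∈ {s | s ∈ l}, {w | RingsIn w a s} := by
      ext w; simp
    rw [this]
    exact .biInter (Set.to_countable _) fun s _ => measurableSet_ringsIn a s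
  have hinj : Function.Injective fun s : Site => (s, 0) := fun _ _ h => (Prod.ext_iff.1 h).1
  have hbound := noiseLaw_forall_le (l.toFinset.map ⟨fun s => (s, 0), hinj⟩)
    (δ := 1 / 8) (by norm_num)
  rw [Finset.card_map, List.toFinset_card_of_nodup hl] at hbound
  rw [← (measurePreserving_spliceNoise ha).measure_preimage hm.nullMeasurableSet]
  refine le_trans ?_ hbound
  rw [← (measurePreserving_snd (μ := noiseLaw) (ν := noiseLaw)).measure_preimage
    (MeasurableSet.nullMeasurableSet ?_)]
  · refine measure_mono_ae ?_
    filter_upwards [Measure.quasiMeasurePreserving_fst.ae ae_regularClocks,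
      Measure.quasiMeasurePreserving_snd.ae ae_regularClocks] with q hx hy hq p hp
    obtain ⟨s, hs, rfl⟩ := Finset.mem_map.1 hp
    obtain ⟨k, hk1, hk2⟩ := hq s (List.mem_toFinset.1 hs)
    change (q.2 (s, 0)).1 ≤ 1 / 8
    rcases lt_or_ge k (ringsUpTo q.1 s a) with hk | hk
    · rw [hx.ringTime_splice_of_lt q.2 hk] at hk1
      exact absurd (hx.lt_ringsUpTo_iff.1 hk) (not_le.2 hk1)
    · obtain ⟨m, rfl⟩ := Nat.exists_eq_add_of_le hk
      rw [hx.ringTime_splice_add] at hk2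
      have := (hy.strictMono s).monotone (Nat.zero_le m)
      rw [ringTime_zero] at this
      linarith
  · have : {w : Noise | ∀ p ∈ l.toFinset.map ⟨fun s : Site => (s, 0), hinj⟩, (w p).1 ≤ 1 / 8} =
      ⋂ p ∈ {p | p ∈ l.toFinset.map ⟨fun s : Site => (s, 0), hinj⟩}, {w | (w p).1 ≤ 1 / 8} := by
      ext w; simp
    rw [this]
    exact .biInter (Set.to_countable _) fun p _ => measurableSet_le (by fun_prop) measurable_const

/-- Since `4 * (1/8) < 1`, the sites that ring in a window of length `1/8` do not percolate. -/
theorem ae_exists_forall_walks {a : ℝ} (ha : 0 ≤ a) (i : Site) : ∀ᵐ w ∂noiseLaw,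
    ∃ n, ∀ l ∈ walks n i, l.Nodup → ¬ ∀ s ∈ l, RingsIn w a s := by
  rw [ae_iff, ← nonpos_iff_eq_zero]
  have hlim : Tendsto (fun n : ℕ => ENNReal.ofReal (1 / 2) ^ n) atTop (𝓝 0) :=
    ENNReal.tendsto_pow_atTop_nhds_zero_of_lt_one
      (ENNReal.ofReal_lt_one.2 (by norm_num))
  refine ge_of_tendsto' hlim fun n => ?_
  calc noiseLaw {w | ¬ ∃ n, ∀ l ∈ walks n i, l.Nodup → ¬ ∀ s ∈ l, RingsIn w a s}
      ≤ noiseLaw (⋃ l ∈ (walks n i).toFinset.filter List.Nodup, {w | ∀ s ∈ l, RingsIn w a s}) := by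
        refine measure_mono fun w hw => ?_
        have hw' : ¬ ∃ n, ∀ l ∈ walks n i, l.Nodup → ¬ ∀ s ∈ l, RingsIn w a s := hw
        push Not at hw'
        obtain ⟨l, hl, hnd, h⟩ := hw' n
        simp only [Set.mem_iUnion]
        exact ⟨l, by simp [hl, hnd], h⟩
    _ ≤ ∑ l ∈ (walks n i).toFinset.filter List.Nodup, noiseLaw {w | ∀ s ∈ l, RingsIn w a s} :=
        measure_biUnion_finset_le _ _
    _ ≤ ∑ l ∈ (walks n i).toFinset.filter List.Nodup, ENNReal.ofReal (1 / 8) ^ n := by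
        refine Finset.sum_le_sum fun l hl => ?_
        rw [Finset.mem_filter, List.mem_toFinset] at hl
        refine (noiseLaw_forall_ringsIn ha hl.2).trans (pow_le_pow_right_of_le_one' ?_ ?_)
        · exact ENNReal.ofReal_le_one.2 (by norm_num)
        · rw [length_of_mem_walks hl.1]; omega
    _ ≤ (4 : ℝ≥0∞) ^ n * ENNReal.ofReal (1 / 8) ^ n := by
        rw [Finset.sum_const, nsmul_eq_mul]
        refine mul_le_mul_left ?_ _
        have : ((walks n i).toFinset.filter List.Nodup).card ≤ 4 ^ n :=
          (Finset.card_filter_le _ _).trans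
            ((List.toFinset_card_le _).trans (length_walks n i).le)
        exact_mod_cast this
    _ = ENNReal.ofReal (1 / 2) ^ n := by
        rw [← mul_pow, ← ENNReal.ofReal_ofNat, ← ENNReal.ofReal_mul (by norm_num)]
        norm_num

/-! ### Finiteness of the backward exploration -/

/-- One step of the backward exploration: the state of the site `p.1` after `p.2` rings is computed
from the states of its neighbours `q.1` after the `q.2` rings that precede the last of them. -/
def Precedes (w : Noise) (q p : Site × ℕ) : Prop :=
  ∃ m, p.2 = m + 1 ∧ q.1 ∈ neighbors p.1 ∧ q.2 = ringsBefore w q.1 (ringTime w p.1 m)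

/-- Noise realizations for which the graphical construction works. -/
structure RegularNoise (w : Noise) : Prop extends RegularClocks w where
  wellFounded : WellFounded (Precedes w)

/-- Along an infinite exploration the ring times decrease, so all but finitely many lie in one
window of length `1/8`; the sites rung there are visited finitely often each, hence percolate. -/
theorem RegularClocks.wellFounded {w : Noise} (h : RegularClocks w)
    (hperc : ∀ (j : ℕ) (i : Site),
      ∃ n, ∀ l ∈ walks n i, l.Nodup → ¬ ∀ s ∈ l, RingsIn w (j / 8) s) :
    WellFounded (Precedes w) := by
  rw [wellFounded_iff_isEmpty_descending_chain]
  refine ⟨fun ⟨f, hf⟩ => ?_⟩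
  choose m hm hnbr hcount using hf
  set τ : ℕ → ℝ := fun n => ringTime w (f n).1 (m n) with hτ
  have hanti : StrictAnti τ := strictAnti_nat_of_succ_lt fun n => by
    refine h.lt_ringsBefore_iff.1 ?_
    rw [← hcount n, hm (n + 1)]
    exact Nat.lt_succ_self _
  -- `k` is a moment from which the window number does not decrease any more.
  obtain ⟨k, hk⟩ : ∃ k, ∀ n, ⌈τ k * 8⌉₊ ≤ ⌈τ n * 8⌉₊ :=
    ⟨Function.argmin fun n => ⌈τ n * 8⌉₊, fun n => Function.argmin_le (fun n => ⌈τ n * 8⌉₊) n⟩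
  have hτpos : ∀ n, 0 < τ n := fun n => h.ringTime_pos _ _
  obtain ⟨j, hj⟩ : ∃ j, ⌈τ k * 8⌉₊ = j + 1 :=
    Nat.exists_eq_succ_of_ne_zero (Nat.ceil_pos.2 (mul_pos (hτpos k) (by norm_num))).ne'
  have hwin : ∀ n ≥ k, RingsIn w (j / 8) (f n).1 := by
    intro n hn
    have h1 : j < ⌈τ n * 8⌉₊ := by have := hk n; omega
    have h2 : τ n * 8 ≤ ((j + 1 : ℕ) : ℝ) := by
      rw [← hj]
      exact (mul_le_mul_of_nonneg_right (hanti.antitone hn) (by norm_num)).trans (Nat.le_ceil _)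
    rw [Nat.lt_ceil] at h1
    push_cast at h2
    exact ⟨m n, by change (j : ℝ) / 8 < τ n; linarith,
      by change τ n ≤ (j : ℝ) / 8 + 1 / 8; linarith⟩
  have hfin : ∀ s, {n | (f (k + n)).1 = s}.Finite := by
    intro s
    have hinj : Set.InjOn (fun n => m (k + n)) {n | (f (k + n)).1 = s} := by
      intro a ha b hb hab
      have hτab : τ (k + a) = τ (k + b) := by
        simp only [hτ]
        rw [show (f (k + a)).1 = s from ha, show (f (k + b)).1 = s from hb,
          show m (k + a) = m (k + b) from hab]
      simpa using hanti.injective hτab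
    refine Set.Finite.of_finite_image (f := fun n => m (k + n)) ?_ hinj
    rcases Set.eq_empty_or_nonempty {n | (f (k + n)).1 = s} with he | ⟨a, ha⟩
    · simp [he]
    obtain ⟨N, hN⟩ := ((h.tendsto s).eventually_gt_atTop (τ k)).exists
    refine (Set.finite_Iio N).subset ?_
    rintro _ ⟨b, hb, rfl⟩
    refine (h.strictMono s).lt_iff_lt.1 (lt_of_le_of_lt ?_ hN)
    rw [← show (f (k + b)).1 = s from hb]
    exact hanti.antitone (Nat.le_add_right k b)
  obtain ⟨n, hn⟩ := hperc j (f k).1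
  obtain ⟨l, hl, hnd, hvis⟩ := exists_nodup_mem_walks n (fun a => (f (k + a)).1)
    (fun a => hnbr (k + a)) hfin
  refine hn l hl hnd fun s hs => ?_
  obtain ⟨a, rfl⟩ := hvis s hs
  exact hwin _ (Nat.le_add_right k a)

theorem ae_regularNoise : ∀ᵐ w ∂noiseLaw, RegularNoise w := by
  have : ∀ᵐ w ∂noiseLaw, ∀ (j : ℕ) (i : Site),
      ∃ n, ∀ l ∈ walks n i, l.Nodup → ¬ ∀ s ∈ l, RingsIn w (j / 8) s :=
    ae_all_iff.2 fun j => ae_all_iff.2 fun i => ae_exists_forall_walks (by positivity) i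
  filter_upwards [ae_regularClocks, this] with w hw hp
  exact ⟨hw, hw.wellFounded hp⟩

/-! ### The process on regular noise -/

theorem heatBath_congr {β v : ℝ} {i : Site} {σ σ' : Config} (h : ∀ j ∈ neighbors i, σ j = σ' j) :
    heatBath β v σ i = heatBath β v σ' i := by
  simp only [neighbors, List.forall_mem_cons] at h
  obtain ⟨h1, h2, h3, h4, -⟩ := h
  have : plusProb β σ i = plusProb β σ' i := by simp only [plusProb, localField, h1, h2, h3, h4]
  rw [heatBath, heatBath, this]

open Classical in
/-- The spin at `i` after the first `m` rings of its clock: the eventual value of `spinAfter`,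
and `false` where there is none. -/
noncomputable def limitSpin (β : ℝ) (ξ : Config) (w : Noise) (i : Site) (m : ℕ) : Bool :=
  decide (∀ᶠ n in atTop, spinAfter β ξ w n i m = true)

theorem harrisState_apply (β : ℝ) (ξ : Config) (w : Noise) (t : ℝ≥0) (i : Site) :
    harrisState β ξ w t i = limitSpin β ξ w i (ringsUpTo w i t) := rfl

theorem limitSpin_eq {β : ℝ} {ξ : Config} {w : Noise} {i : Site} {m : ℕ} {b : Bool}
    (h : ∀ᶠ n in atTop, spinAfter β ξ w n i m = b) : limitSpin β ξ w i m = b := by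
  cases b with
  | true => simpa [limitSpin] using h
  | false =>
    rw [limitSpin, decide_eq_false_iff_not]
    intro h'
    obtain ⟨n, h1, h2⟩ := (h.and h').exists
    simp [h1] at h2

theorem spinAfter_zero (β : ℝ) (ξ : Config) (w : Noise) (n : ℕ) (i : Site) :
    spinAfter β ξ w n i 0 = ξ i := by
  cases n <;> rfl

theorem limitSpin_zero (β : ℝ) (ξ : Config) (w : Noise) (i : Site) :
    limitSpin β ξ w i 0 = ξ i :=
  limitSpin_eq (.of_forall fun n => spinAfter_zero β ξ w n i)

/-- If the exploration below ring `m` of `i` has stabilized, so has the update at this ring. -/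
theorem eventually_spinAfter_succ {β : ℝ} {ξ : Config} {w : Noise} {i : Site} {m : ℕ}
    (h : ∀ j ∈ neighbors i, ∀ᶠ n in atTop,
      spinAfter β ξ w n j (ringsBefore w j (ringTime w i m)) =
        limitSpin β ξ w j (ringsBefore w j (ringTime w i m))) :
    ∀ᶠ n in atTop, spinAfter β ξ w n i (m + 1) = heatBath β (mark w i m)
      (fun j => limitSpin β ξ w j (ringsBefore w j (ringTime w i m))) i := by
  rw [← map_add_atTop_eq_nat 1, eventually_map]
  filter_upwards [(eventually_all_finite (neighbors i).finite_toSet).2 h] with n hn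
  exact heatBath_congr hn

theorem RegularNoise.eventually_spinAfter {w : Noise} (h : RegularNoise w) (β : ℝ) (ξ : Config)
    (i : Site) (m : ℕ) : ∀ᶠ n in atTop, spinAfter β ξ w n i m = limitSpin β ξ w i m := by
  suffices H : ∀ p : Site × ℕ, ∃ b, ∀ᶠ n in atTop, spinAfter β ξ w n p.1 p.2 = b by
    obtain ⟨b, hb⟩ := H (i, m)
    rwa [limitSpin_eq hb]
  intro p
  induction p using h.wellFounded.induction with
  | _ p ih =>
    obtain ⟨i, m⟩ := p
    cases m with
    | zero => exact ⟨ξ i, .of_forall fun n => spinAfter_zero β ξ w n i⟩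
    | succ m =>
      refine ⟨_, eventually_spinAfter_succ fun j hj => ?_⟩
      obtain ⟨b, hb⟩ := ih (j, ringsBefore w j (ringTime w i m)) ⟨m, rfl, hj, rfl⟩
      rwa [limitSpin_eq hb]

theorem RegularNoise.limitSpin_succ {w : Noise} (h : RegularNoise w) (β : ℝ) (ξ : Config)
    (i : Site) (m : ℕ) : limitSpin β ξ w i (m + 1) = heatBath β (mark w i m)
      (fun j => limitSpin β ξ w j (ringsBefore w j (ringTime w i m))) i :=
  limitSpin_eq (eventually_spinAfter_succ fun j _ => h.eventually_spinAfter β ξ j _)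

/-- The spin at `i` is a function of the number of rings at `i`, which is constant
immediately to the right of `t`, and immediately to the left of `t` is the number of rings strictly
before `t`. -/
theorem RegularClocks.isCadlag {w : Noise} (h : RegularClocks w) (β : ℝ) (ξ : Config) :
    IsCadlag (harrisState β ξ w) := by
  intro t
  have hcoe : Tendsto (fun s : ℝ≥0 => (s : ℝ)) (𝓝 t) (𝓝 (t : ℝ)) := NNReal.continuous_coe.tendsto t
  constructor
  · rw [continuousWithinAt_pi]
    intro i
    have hlt : (t : ℝ) < ringTime w i (ringsUpTo w i t) :=
      not_le.1 (mt h.lt_ringsUpTo_iff.2 (lt_irrefl _))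
    refine tendsto_const_nhds.congr' ?_
    filter_upwards [(hcoe.eventually_lt_const hlt).filter_mono nhdsWithin_le_nhds,
      self_mem_nhdsWithin] with s hs hts
    rw [harrisState_apply, harrisState_apply]
    congr 1
    refine eq_of_forall_lt_iff fun k => ⟨fun hk => ?_, fun hk => ?_⟩
    · exact h.lt_ringsUpTo_iff.2 ((h.lt_ringsUpTo_iff.1 hk).trans (NNReal.coe_le_coe.2 hts))
    · exact (h.strictMono i).lt_iff_lt.1 ((h.lt_ringsUpTo_iff.1 hk).trans_lt hs)
  · refine ⟨fun i => limitSpin β ξ w i (ringsBefore w i t), tendsto_pi_nhds.2 fun i => ?_⟩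
    refine tendsto_const_nhds.congr' ?_
    have hev : ∀ᶠ s : ℝ≥0 in 𝓝 t, ∀ k ∈ Set.Iio (ringsBefore w i t), ringTime w i k < s :=
      (eventually_all_finite (Set.finite_Iio _)).2 fun k hk =>
        hcoe.eventually_const_lt (h.lt_ringsBefore_iff.1 hk)
    filter_upwards [hev.filter_mono nhdsWithin_le_nhds, self_mem_nhdsWithin] with s hs hst
    rw [harrisState_apply]
    congr 1
    refine eq_of_forall_lt_iff fun k => ⟨fun hk => ?_, fun hk => ?_⟩
    · exact h.lt_ringsUpTo_iff.2 (hs k hk).le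
    · exact h.lt_ringsBefore_iff.2
        ((h.lt_ringsUpTo_iff.1 hk).trans_lt (NNReal.coe_lt_coe.2 hst))

theorem RegularClocks.harrisState_zero {w : Noise} (h : RegularClocks w) (β : ℝ) (ξ : Config) :
    harrisState β ξ w 0 = ξ := by
  funext i
  have : ringsUpTo w i 0 = 0 := Nat.eq_zero_of_not_pos fun h0 =>
    absurd (h.lt_ringsUpTo_iff.1 h0) (not_le.2 (h.ringTime_pos i 0))
  rw [harrisState_apply, NNReal.coe_zero, this, limitSpin_zero]

/-! ### The flow property -/

section Splice

variable {x y : Noise} {u : ℝ} {i : Site}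

theorem ringsBefore_splice_of_le (hx : RegularClocks x) (hy : RegularClocks y)
    (hz : RegularClocks (spliceNoise u x y)) {s : ℝ} (hs : s ≤ u) :
    ringsBefore (spliceNoise u x y) i s = ringsBefore x i s := by
  refine eq_of_forall_lt_iff fun k => ?_
  rw [hz.lt_ringsBefore_iff, hx.lt_ringsBefore_iff]
  rcases lt_or_ge k (ringsUpTo x i u) with hk | hk
  · rw [hx.ringTime_splice_of_lt y hk]
  · have h1 : u < ringTime x i k := not_le.1 (mt hx.lt_ringsUpTo_iff.2 (not_lt.2 hk))
    obtain ⟨m, rfl⟩ := Nat.exists_eq_add_of_le hk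
    rw [hx.ringTime_splice_add]
    have := hy.ringTime_pos i m
    exact iff_of_false (by linarith) (by linarith)

theorem ringsBefore_splice_add (hx : RegularClocks x) (hy : RegularClocks y)
    (hz : RegularClocks (spliceNoise u x y)) {r : ℝ} (hr : 0 < r) :
    ringsBefore (spliceNoise u x y) i (u + r) = ringsUpTo x i u + ringsBefore y i r := by
  refine eq_of_forall_lt_iff fun k => ?_
  rw [hz.lt_ringsBefore_iff]
  rcases lt_or_ge k (ringsUpTo x i u) with hk | hk
  · rw [hx.ringTime_splice_of_lt y hk]
    have := hx.lt_ringsUpTo_iff.1 hk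
    exact iff_of_true (by linarith) (by omega)
  · obtain ⟨m, rfl⟩ := Nat.exists_eq_add_of_le hk
    rw [hx.ringTime_splice_add, add_lt_add_iff_left, add_lt_add_iff_left, hy.lt_ringsBefore_iff]

theorem ringsUpTo_splice_add (hx : RegularClocks x) (hy : RegularClocks y)
    (hz : RegularClocks (spliceNoise u x y)) {r : ℝ} (hr : 0 ≤ r) :
    ringsUpTo (spliceNoise u x y) i (u + r) = ringsUpTo x i u + ringsUpTo y i r := by
  refine eq_of_forall_lt_iff fun k => ?_
  rw [hz.lt_ringsUpTo_iff]
  rcases lt_or_ge k (ringsUpTo x i u) with hk | hk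
  · rw [hx.ringTime_splice_of_lt y hk]
    have := hx.lt_ringsUpTo_iff.1 hk
    exact iff_of_true (by linarith) (by omega)
  · obtain ⟨m, rfl⟩ := Nat.exists_eq_add_of_le hk
    rw [hx.ringTime_splice_add, add_le_add_iff_left, add_lt_add_iff_left, hy.lt_ringsUpTo_iff]

/-- Up to time `u` the process only depends on the noise up to time `u`. -/
theorem spinAfter_splice_of_le (hx : RegularClocks x) (hy : RegularClocks y)
    (hz : RegularClocks (spliceNoise u x y)) (β : ℝ) (ξ : Config) (n : ℕ) (i : Site) {m : ℕ}
    (hm : m ≤ ringsUpTo x i u) :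
    spinAfter β ξ (spliceNoise u x y) n i m = spinAfter β ξ x n i m := by
  induction n generalizing i m with
  | zero => rfl
  | succ n ih =>
    cases m with
    | zero => rfl
    | succ m =>
      have hle : ringTime x i m ≤ u := hx.lt_ringsUpTo_iff.1 hm
      simp only [spinAfter]
      rw [hx.mark_splice_of_lt y hm, hx.ringTime_splice_of_lt y hm]
      congr 1
      funext j
      rw [ringsBefore_splice_of_le hx hy hz hle]
      refine ih j (le_of_forall_lt fun k hk => ?_)
      exact hx.lt_ringsUpTo_iff.2 ((hx.lt_ringsBefore_iff.1 hk).le.trans hle)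

theorem limitSpin_splice_of_le (hx : RegularClocks x) (hy : RegularClocks y)
    (hz : RegularClocks (spliceNoise u x y)) (β : ℝ) (ξ : Config) (i : Site) {m : ℕ}
    (hm : m ≤ ringsUpTo x i u) :
    limitSpin β ξ (spliceNoise u x y) i m = limitSpin β ξ x i m := by
  rw [limitSpin, limitSpin, decide_eq_decide]
  simp only [spinAfter_splice_of_le hx hy hz β ξ _ i hm]

/-- Both sides solve the same recursion along the well-founded exploration of `y`; where it starts,
the left side is the state under `x` at time `u`. -/
theorem limitSpin_splice_add {u : ℝ≥0} (hx : RegularClocks x) (hy : RegularNoise y)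
    (hz : RegularNoise (spliceNoise u x y)) (β : ℝ) (ξ : Config) (p : Site × ℕ) :
    limitSpin β ξ (spliceNoise u x y) p.1 (ringsUpTo x p.1 u + p.2) =
      limitSpin β (harrisState β ξ x u) y p.1 p.2 := by
  induction p using hy.wellFounded.induction with
  | _ p ih =>
    obtain ⟨i, m⟩ := p
    cases m with
    | zero =>
      rw [limitSpin_zero, harrisState_apply]
      exact limitSpin_splice_of_le hx hy.toRegularClocks hz.toRegularClocks β ξ i le_rfl
    | succ m =>
      rw [hy.limitSpin_succ]
      change limitSpin β ξ _ i (ringsUpTo x i u + m + 1) = _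
      rw [hz.limitSpin_succ, hx.mark_splice_add, hx.ringTime_splice_add]
      refine heatBath_congr fun j hj => ?_
      rw [ringsBefore_splice_add hx hy.toRegularClocks hz.toRegularClocks (hy.ringTime_pos i m)]
      exact ih (j, _) ⟨m, rfl, hj, rfl⟩

/-- The flow property: after time `u` the process driven by the spliced noise is the process driven
by `y`, started from the state reached under `x` at time `u`. -/
theorem harrisState_splice_add {u : ℝ≥0} (hx : RegularClocks x) (hy : RegularNoise y)
    (hz : RegularNoise (spliceNoise u x y)) (β : ℝ) (ξ : Config) (s : ℝ≥0) :
    harrisState β ξ (spliceNoise u x y) (u + s) =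
      harrisState β (harrisState β ξ x u) y s := by
  funext i
  rw [harrisState_apply, NNReal.coe_add,
    ringsUpTo_splice_add hx hy.toRegularClocks hz.toRegularClocks s.coe_nonneg]
  exact limitSpin_splice_add hx hy hz β ξ (i, _)

end Splice

/-! ### Measurability of the graphical construction -/

/-- No finiteness is needed: where the set is infinite its `ncard` is the constant `0`. -/
theorem measurable_ncard {α : Type*} [MeasurableSpace α] {p : α → ℕ → Prop}
    (hp : ∀ k, MeasurableSet {a | p a k}) : Measurable fun a => {k | p a k}.ncard := by
  have hF : ∀ F : Finset ℕ, MeasurableSet {a | {k | p a k} = F} := fun F => by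
    have : {a | {k | p a k} = F} = ⋂ k, {a | p a k ↔ k ∈ F} := by
      ext a; simp [Set.ext_iff]
    rw [this]
    exact .iInter fun k => (hp k).iff (.const _)
  refine measurable_to_countable' fun n => ?_
  have hset : (fun a => {k | p a k}.ncard) ⁻¹' {n} =
      (⋃ F ∈ {F : Finset ℕ | F.card = n}, {a | {k | p a k} = F}) ∪
        ((⋃ F : Finset ℕ, {a | {k | p a k} = F})ᶜ ∩ {_a | n = 0}) := by
    ext a
    simp only [Set.mem_preimage, Set.mem_singleton_iff, Set.mem_union, Set.mem_iUnion,
      Set.mem_inter_iff, Set.mem_compl_iff, Set.mem_ofPred_eq, exists_prop]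
    constructor
    · intro h
      by_cases hfin : {k | p a k}.Finite
      · left
        refine ⟨hfin.toFinset, ?_, hfin.coe_toFinset.symm⟩
        rw [← h, Set.ncard_eq_toFinset_card _ hfin]
      · right
        refine ⟨fun ⟨F, hF⟩ => hfin (hF ▸ F.finite_toSet), ?_⟩
        rw [← h, Set.Infinite.ncard hfin]
    · rintro (⟨F, hF, h⟩ | ⟨h, h0⟩)
      · rw [h, Set.ncard_coe_finset, hF]
      · rw [h0, Set.Infinite.ncard]
        exact fun hfin => h ⟨hfin.toFinset, hfin.coe_toFinset.symm⟩
  rw [hset]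
  exact (MeasurableSet.biUnion (Set.to_countable _) fun F _ => hF F).union
    ((MeasurableSet.iUnion hF).compl.inter (.const _))

theorem measurable_ringsBefore (i j : Site) (m : ℕ) :
    Measurable fun w => ringsBefore w j (ringTime w i m) :=
  measurable_ncard fun k => measurableSet_lt (measurable_ringTime j k) (measurable_ringTime i m)

theorem measurable_ringsUpTo (i : Site) (s : ℝ) : Measurable fun w => ringsUpTo w i s :=
  measurable_ncard fun k => measurableSet_le (measurable_ringTime i k) measurable_const

theorem measurable_plusProb (β : ℝ) (i : Site) : Measurable fun σ => plusProb β σ i := by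
  have hs : Measurable spinValue := measurable_from_top
  have hj : ∀ j : Site, Measurable fun σ : Config => spinValue (σ j) :=
    fun j => hs.comp (measurable_pi_apply j)
  have hf : Measurable fun σ => localField σ i :=
    (((hj _).add (hj _)).add (hj _)).add (hj _)
  unfold plusProb
  fun_prop

theorem measurable_heatBath (β : ℝ) (i : Site) :
    Measurable fun p : ℝ × Config => heatBath β p.1 p.2 i := by
  refine measurable_to_bool ?_
  have : (fun p : ℝ × Config => heatBath β p.1 p.2 i) ⁻¹' {true} =
      {p | p.1 ≤ plusProb β p.2 i} := by
    ext p; simp [heatBath]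
  rw [this]
  exact measurableSet_le measurable_fst ((measurable_plusProb β i).comp measurable_snd)

theorem measurable_apply_nat {α β : Type*} [MeasurableSpace α] [MeasurableSpace β]
    {f : ℕ → α → β} {N : α → ℕ} (hf : ∀ k, Measurable (f k)) (hN : Measurable N) :
    Measurable fun a => f (N a) a :=
  (measurable_from_prod_countable_right (f := fun p : ℕ × α => f p.1 p.2) hf).comp
    (hN.prodMk measurable_id)

theorem measurable_spinAfter (β : ℝ) (n : ℕ) (i : Site) (m : ℕ) :
    Measurable fun q : Config × Noise => spinAfter β q.1 q.2 n i m := by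
  induction n generalizing i m with
  | zero => simp only [spinAfter]; fun_prop
  | succ n ih =>
    cases m with
    | zero => simp only [spinAfter]; fun_prop
    | succ m =>
      simp only [spinAfter]
      refine (measurable_heatBath β i).comp
        (f := fun q : Config × Noise => (mark q.2 i m, fun j =>
          spinAfter β q.1 q.2 n j (ringsBefore q.2 j (ringTime q.2 i m))))
        (Measurable.prodMk ?_ (measurable_pi_iff.2 fun j => ?_))
      · unfold mark; fun_prop
      · exact measurable_apply_nat (f := fun k (q : Config × Noise) => spinAfter β q.1 q.2 n j k)
          (ih j) ((measurable_ringsBefore i j m).comp measurable_snd)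

theorem measurableSet_eventually_nat {α : Type*} [MeasurableSpace α] {p : ℕ → α → Prop}
    (hp : ∀ n, MeasurableSet {a | p n a}) : MeasurableSet {a | ∀ᶠ n in atTop, p n a} := by
  simp only [eventually_atTop, Set.ofPred_exists, Set.ofPred_forall]
  exact .iUnion fun N => .iInter fun n => .iInter fun _ => hp n

theorem measurable_harrisState (β : ℝ) (t : ℝ≥0) :
    Measurable fun q : Config × Noise => harrisState β q.1 q.2 t := by
  refine measurable_pi_iff.2 fun i => ?_
  refine measurable_apply_nat (f := fun k (q : Config × Noise) => limitSpin β q.1 q.2 i k)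
    (fun k => measurable_to_bool ?_) ((measurable_ringsUpTo i t).comp measurable_snd)
  have : (fun q : Config × Noise => limitSpin β q.1 q.2 i k) ⁻¹' {true} =
      {q | ∀ᶠ n in atTop, spinAfter β q.1 q.2 n i k = true} := by
    ext q; simp [limitSpin]
  rw [this]
  exact measurableSet_eventually_nat fun n => measurable_spinAfter β n i k (.singleton true)

theorem measurable_harrisState_noise (β : ℝ) (ξ : Config) (t : ℝ≥0) :
    Measurable fun w => harrisState β ξ w t :=
  (measurable_harrisState β t).comp (measurable_const.prodMk measurable_id)

theorem harrisPath_val {w : Noise} (h : RegularClocks w) (β : ℝ) (ξ : Config) :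
    (harrisPath β ξ w).1 = harrisState β ξ w := by
  rw [harrisPath, dif_pos (h.isCadlag β ξ)]

/-- The set of noises with a càdlàg trajectory need not be measurable; on a measurable set of
regular clocks of full measure the trajectory is a measurable function of the noise. -/
theorem aemeasurable_harrisPath (β : ℝ) (ξ : Config) :
    AEMeasurable (harrisPath β ξ) noiseLaw := by
  classical
  set A : Set Noise := (toMeasurable noiseLaw {w | ¬ RegularClocks w})ᶜ
  have hA : MeasurableSet A := (measurableSet_toMeasurable _ _).compl
  have hreg : ∀ w ∈ A, RegularClocks w := fun w hw => by
    by_contra hcon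
    exact hw (subset_toMeasurable _ _ hcon)
  have hAae : ∀ᵐ w ∂noiseLaw, w ∈ A := by
    rw [ae_iff]
    simpa [A, Set.compl_def] using ae_iff.1 ae_regularClocks
  refine ⟨fun w => if w ∈ A then harrisPath β ξ w else ⟨fun _ => ξ, isCadlag_const ξ⟩, ?_, ?_⟩
  · have hval : Measurable fun w =>
        (if w ∈ A then harrisPath β ξ w else ⟨fun _ => ξ, isCadlag_const ξ⟩ : PathSpace).1 := by
      refine measurable_pi_iff.2 fun t => ?_
      have : (fun w => (if w ∈ A then harrisPath β ξ w
            else ⟨fun _ => ξ, isCadlag_const ξ⟩ : PathSpace).1 t) =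
          fun w => if w ∈ A then harrisState β ξ w t else ξ := by
        funext w
        by_cases hw : w ∈ A
        · simp [hw, harrisPath_val (hreg w hw)]
        · simp [hw]
      rw [this]
      exact Measurable.ite hA (measurable_harrisState_noise β ξ t) measurable_const
    exact hval.subtype_mk
  · filter_upwards [hAae] with w hw
    rw [if_pos hw]

theorem map_pathLaw {X : Type*} [MeasurableSpace X] (β : ℝ) (ξ : Config) {f : PathSpace → X}
    (hf : Measurable f) : (pathLaw β ξ).map f = noiseLaw.map fun w => f (harrisPath β ξ w) :=
  AEMeasurable.map_map_of_aemeasurable hf.aemeasurable (aemeasurable_harrisPath β ξ)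

theorem transition_eq_map (β : ℝ) (u : ℝ≥0) (ξ : Config) :
    transition β u ξ = noiseLaw.map fun w => harrisState β ξ w u := by
  have hu : Measurable fun ω : PathSpace => ω.1 u :=
    (measurable_pi_apply u).comp measurable_subtype_coe
  rw [transition, map_pathLaw β ξ hu]
  refine Measure.map_congr ?_
  filter_upwards [ae_regularClocks] with w hw
  rw [harrisPath_val hw]

/-! ### Leaving a Borel set is an analytic event -/

/-- The restriction of a path to the times `k / (n + 1)`; the pair `(n, k)` stands for this time. -/
noncomputable def sampleGrid (ω : ℝ≥0 → Config) : ℕ × ℕ → Config := fun p => ω (p.2 / (p.1 + 1))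

open Classical in
/-- The value at time `t` of the path with grid values `g`, read off from grid times that approach
`t` from the right. -/
noncomputable def fromGrid (t : ℝ≥0) (g : ℕ × ℕ → Config) : Config := fun i =>
  decide (∀ᶠ n : ℕ in atTop, g (n, ⌊t * (n + 1)⌋₊ + 1) i = true)

theorem tendsto_grid (t : ℝ≥0) : Tendsto (fun n : ℕ =>
    ((⌊t * (n + 1)⌋₊ + 1 : ℕ) : ℝ≥0) / ((n : ℝ≥0) + 1)) atTop (𝓝[≥] t) := by
  have hpos : ∀ n : ℕ, (0 : ℝ≥0) < n + 1 := fun n => by positivity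
  refine tendsto_nhdsWithin_iff.2 ⟨?_, .of_forall fun n => ?_⟩
  · have hup : Tendsto (fun n : ℕ => t + 1 / ((n : ℝ≥0) + 1)) atTop (𝓝 t) := by
      simpa using tendsto_const_nhds.add (tendsto_one_div_add_atTop_nhds_zero_nat (𝕜 := ℝ≥0))
    refine tendsto_of_tendsto_of_tendsto_of_le_of_le tendsto_const_nhds hup
      (fun n => ?_) fun n => ?_
    · change t ≤ _
      rw [le_div_iff₀ (hpos n)]
      push_cast
      exact (Nat.lt_floor_add_one _).le
    · change _ ≤ t + 1 / ((n : ℝ≥0) + 1)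
      rw [div_le_iff₀ (hpos n), add_mul, one_div, inv_mul_cancel₀ (hpos n).ne']
      push_cast
      gcongr
      exact Nat.floor_le zero_le
  · change t ≤ _
    rw [le_div_iff₀ (hpos n)]
    push_cast
    exact (Nat.lt_floor_add_one _).le

theorem fromGrid_sampleGrid {ω : ℝ≥0 → Config} (h : IsCadlag ω) (t : ℝ≥0) :
    fromGrid t (sampleGrid ω) = ω t := by
  funext i
  have h1 : Tendsto (fun n : ℕ => sampleGrid ω (n, ⌊t * (n + 1)⌋₊ + 1) i) atTop (𝓝 (ω t i)) :=
    ((continuous_apply i).tendsto _).comp ((h t).1.tendsto.comp (tendsto_grid t))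
  rw [nhds_discrete, tendsto_pure] at h1
  rw [fromGrid]
  cases hb : ω t i with
  | true => simpa [hb] using h1
  | false =>
    rw [decide_eq_false_iff_not]
    intro h2
    obtain ⟨n, h3, h4⟩ := (h1.and h2).exists
    simp [h4, hb] at h3

theorem measurable_fromGrid :
    Measurable fun p : ℝ≥0 × (ℕ × ℕ → Config) => fromGrid p.1 p.2 := by
  refine measurable_pi_iff.2 fun i => measurable_to_bool ?_
  have : (fun p : ℝ≥0 × (ℕ × ℕ → Config) => fromGrid p.1 p.2 i) ⁻¹' {true} =
      {p | ∀ᶠ n : ℕ in atTop, p.2 (n, ⌊p.1 * (n + 1)⌋₊ + 1) i = true} := by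
    ext p; simp [fromGrid]
  rw [this]
  refine measurableSet_eventually_nat fun n => ?_
  refine (measurable_apply_nat (f := fun k (p : ℝ≥0 × (ℕ × ℕ → Config)) => p.2 (n, k + 1) i)
    (N := fun p => ⌊p.1 * (n + 1)⌋₊) (fun k => by fun_prop) ?_) (.singleton true)
  exact Nat.measurable_floor.comp (by fun_prop)

/-- The grid values from which a path is read off that leaves `C` at some time. -/
def exitSamples (C : Set Config) : Set (ℕ × ℕ → Config) := {g | ∃ t, fromGrid t g ∉ C}

theorem sampleGrid_mem_exitSamples {ω : ℝ≥0 → Config} (h : IsCadlag ω) (C : Set Config) :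
    sampleGrid ω ∈ exitSamples C ↔ ∃ t, ω t ∉ C := by
  simp only [exitSamples, Set.mem_ofPred_eq, fromGrid_sampleGrid h]

theorem analyticSet_exitSamples {C : Set Config} (hC : MeasurableSet C) :
    AnalyticSet (exitSamples C) := by
  have : PolishSpace ℝ≥0 := (isClosed_Ici (a := (0 : ℝ))).polishSpace
  have : PolishSpace Bool := inferInstance
  have : PolishSpace Config := inferInstance
  have hm : MeasurableSet {p : ℝ≥0 × (ℕ × ℕ → Config) | fromGrid p.1 p.2 ∉ C} :=
    (measurable_fromGrid hC).compl
  have := hm.analyticSet.image_of_continuous continuous_snd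
  convert this using 1
  ext g
  simp [exitSamples]

theorem nullMeasurableSet_exitSamples {C : Set Config} (hC : MeasurableSet C)
    (μ : Measure (ℕ × ℕ → Config)) [IsFiniteMeasure μ] : NullMeasurableSet (exitSamples C) μ :=
  nullMeasurableSet_of_analyticSet (analyticSet_exitSamples hC) μ

/-! ### Confinement -/

theorem measurable_sampleGrid_harrisState (β : ℝ) :
    Measurable fun q : Config × Noise => sampleGrid (harrisState β q.1 q.2) :=
  measurable_pi_iff.2 fun _ => measurable_harrisState β _

/-- The event of staying in `C` need not be measurable on path space, but it is the preimage of a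
set with analytic complement under `sampleGrid`. Hence its measure under the path law can be
computed on the noise space, which an image measure allows only for null-measurable sets. -/
theorem mem_confinementSet_iff {β : ℝ} {C : Set Config} (hC : MeasurableSet C) {ξ : Config} :
    ξ ∈ confinementSet β C ↔
      ξ ∈ C ∧ ∀ᵐ w ∂noiseLaw, sampleGrid (harrisState β ξ w) ∉ exitSamples C := by
  refine and_congr_right fun _ => ?_
  have hG : Measurable fun ω : PathSpace => sampleGrid ω.1 :=
    measurable_pi_iff.2 fun _ => (measurable_pi_apply _).comp measurable_subtype_coe
  have hH : Measurable fun w => sampleGrid (harrisState β ξ w) :=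
    (measurable_sampleGrid_harrisState β).comp (measurable_const.prodMk measurable_id)
  have hstay : ∀ ω : PathSpace, ω ∈ stayEvent C ↔ sampleGrid ω.1 ∉ exitSamples C := fun ω => by
    rw [sampleGrid_mem_exitSamples ω.2]
    simp [stayEvent]
  have hlaw : (pathLaw β ξ).map (fun ω => sampleGrid ω.1) =
      noiseLaw.map fun w => sampleGrid (harrisState β ξ w) := by
    rw [map_pathLaw β ξ hG]
    refine Measure.map_congr ?_
    filter_upwards [ae_regularClocks] with w hw
    rw [harrisPath_val hw]
  have : IsProbabilityMeasure (noiseLaw.map fun w => sampleGrid (harrisState β ξ w)) :=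
    Measure.isProbabilityMeasure_map hH.aemeasurable
  have hnull := nullMeasurableSet_exitSamples hC
    (noiseLaw.map fun w => sampleGrid (harrisState β ξ w))
  change (∀ᵐ ω ∂(pathLaw β ξ), ω ∈ stayEvent C) ↔ _
  simp only [hstay]
  rw [ae_iff, ae_iff]
  simp only [not_not]
  change (pathLaw β ξ) ((fun ω => sampleGrid ω.1) ⁻¹' exitSamples C) = 0 ↔
    noiseLaw ((fun w => sampleGrid (harrisState β ξ w)) ⁻¹' exitSamples C) = 0
  rw [← Measure.map_apply₀ hH.aemeasurable hnull, ← hlaw,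
    Measure.map_apply₀ hG.aemeasurable (hlaw ▸ hnull)]

/-- Confinement expressed on the noise space. -/
theorem mem_confinementSet_iff_forall {β : ℝ} {C : Set Config} (hC : MeasurableSet C) {ξ : Config} :
    ξ ∈ confinementSet β C ↔ ∀ᵐ w ∂noiseLaw, ∀ t, harrisState β ξ w t ∈ C := by
  have h : (∀ᵐ w ∂noiseLaw, sampleGrid (harrisState β ξ w) ∉ exitSamples C) ↔
      ∀ᵐ w ∂noiseLaw, ∀ t, harrisState β ξ w t ∈ C := by
    refine eventually_congr ?_
    filter_upwards [ae_regularClocks] with w hw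
    rw [sampleGrid_mem_exitSamples (hw.isCadlag β ξ)]
    push Not
    rfl
  rw [mem_confinementSet_iff hC, h]
  refine and_iff_right_of_imp fun hstay => ?_
  obtain ⟨w, hw, hw'⟩ := (ae_regularClocks.and hstay).exists
  simpa [hw.harrisState_zero] using hw' 0

/-- For the law of the grid samples with initial configuration distributed as `μ`, the analytic
set `exitSamples C` agrees up to a null set with a Borel set `B`, and the probability of hitting
`B` is a Borel function of the initial configuration. -/
theorem isUniversallyMeasurable_confinementSet (β : ℝ) {C : Set Config} (hC : MeasurableSet C) :
    IsUniversallyMeasurable (confinementSet β C) := by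
  intro μ _
  have hG := measurable_sampleGrid_harrisState β
  obtain ⟨B, -, hB, hBae⟩ := (nullMeasurableSet_exitSamples hC ((μ.prod noiseLaw).map
    fun q => sampleGrid (harrisState β q.1 q.2))).exists_measurable_superset_ae_eq
  have hae : ∀ᵐ ξ ∂μ, ∀ᵐ w ∂noiseLaw, sampleGrid (harrisState β ξ w) ∈ B ↔
      sampleGrid (harrisState β ξ w) ∈ exitSamples C :=
    Measure.ae_ae_of_ae_prod
      (ae_of_ae_map hG.aemeasurable hBae.mem_iff)
  have hm : MeasurableSet (C ∩ {ξ | noiseLaw (Prod.mk ξ ⁻¹'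
      ((fun q : Config × Noise => sampleGrid (harrisState β q.1 q.2)) ⁻¹' B)) = 0}) :=
    hC.inter (measurable_measure_prodMk_left (hG hB) (.singleton 0))
  refine hm.nullMeasurableSet.congr ?_
  filter_upwards [hae] with ξ hξ
  refine propext ?_
  change (ξ ∈ C ∧ noiseLaw {w | sampleGrid (harrisState β ξ w) ∈ B} = 0) ↔ ξ ∈ confinementSet β C
  rw [mem_confinementSet_iff hC]
  refine and_congr_right fun _ => ?_
  have : noiseLaw {w | sampleGrid (harrisState β ξ w) ∈ B} = 0 ↔
      ∀ᵐ w ∂noiseLaw, sampleGrid (harrisState β ξ w) ∉ B := by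
    rw [ae_iff]; simp only [not_not]
  rw [this]
  exact eventually_congr (hξ.mono fun w hw => not_congr hw)

/-- Almost surely the process started in the confinement set is still in it at time `u`: the path
after time `u` stays in `C`, and given the state at time `u` it is driven by fresh noise. -/
theorem ae_harrisState_mem_confinementSet {β : ℝ} {C : Set Config} (hC : MeasurableSet C)
    {ξ : Config} (hξ : ξ ∈ confinementSet β C) (u : ℝ≥0) :
    ∀ᵐ w ∂noiseLaw, harrisState β ξ w u ∈ confinementSet β C := by
  have hq := (measurePreserving_spliceNoise u.coe_nonneg).quasiMeasurePreserving
  have hpair : ∀ᵐ q ∂noiseLaw.prod noiseLaw,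
      ∀ s, harrisState β (harrisState β ξ q.1 u) q.2 s ∈ C := by
    filter_upwards [hq.ae ((mem_confinementSet_iff_forall hC).1 hξ), hq.ae ae_regularNoise,
      Measure.quasiMeasurePreserving_fst.ae ae_regularClocks,
      Measure.quasiMeasurePreserving_snd.ae ae_regularNoise] with q hstay hz hx hy s
    rw [← harrisState_splice_add hx hy hz]
    exact hstay (u + s)
  filter_upwards [Measure.ae_ae_of_ae_prod hpair] with w hw
  exact (mem_confinementSet_iff_forall hC).2 hw

theorem transition_confinementSet {β : ℝ} {C : Set Config} (hC : MeasurableSet C)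
    {ξ : Config} (hξ : ξ ∈ confinementSet β C) (u : ℝ≥0) :
    transition β u ξ (confinementSet β C) = 1 := by
  have hm := measurable_harrisState_noise β ξ u
  rw [transition_eq_map]
  have : IsProbabilityMeasure (noiseLaw.map fun w => harrisState β ξ w u) :=
    Measure.isProbabilityMeasure_map hm.aemeasurable
  rw [Measure.map_apply₀ hm.aemeasurable
    (isUniversallyMeasurable_confinementSet β hC _ inferInstance)]
  have hae : (fun w => harrisState β ξ w u) ⁻¹' confinementSet β C =ᵐ[noiseLaw] Set.univ :=
    eventuallyEq_univ.2 (ae_harrisState_mem_confinementSet hC hξ u)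
  rw [measure_congr hae, measure_univ]

end IsingGlauber

theorem mainTheorem4 (β : ℝ) (C : Set IsingGlauber.Config) (hC : MeasurableSet C) :
    IsingGlauber.IsUniversallyMeasurable (IsingGlauber.confinementSet β C) ∧
      ∀ ξ ∈ IsingGlauber.confinementSet β C, ∀ u : ℝ≥0,
        IsingGlauber.transition β u ξ (IsingGlauber.confinementSet β C) = 1 :=
  ⟨IsingGlauber.isUniversallyMeasurable_confinementSet β hC,
    fun _ hξ u => IsingGlauber.transition_confinementSet hC hξ u⟩
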